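/- Write $M_n(\mathrm{Ber}(p))$ for a random $n\times n$ matrix with independent entries, each equal to $1$ with probability $p$ and to $0$ with probability $1-p$. For $\delta,\rho\in(0,1)$, a unit vector of $\mathbb{R}^n$ is called $(\delta,\rho)$-compressible if its Euclidean distance to the set of vectors with at most $\delta n$ nonzero coordinates is at most $\rho$. Fix $p\in(0,1/2]$, an integer $k\ge 1$ and $\epsilon>0$. Then there exist $\delta,\rho\in(0,1)$, depending only on $p$, $k$ and $\epsilon$, such that for every integer $n\ge k$, \[\mathbb{P}\bigl[\mathcal{E}_C(\delta,\rho)\bigr]\le(1-p+\epsilon)^{kn},\] where $\mathcal{E}_C(\delta,\rho)$ is the event that, for every $(n-k)\times n$ submatrix $A$ of $M_n(\mathrm{Ber}(p))$, every unit vector $x\in\mathbb{R}^n$ with $Ax=0$ is $(\delta,\rho)$-compressible. (For $n=k$ the only such submatrix has no rows, and every $x\in\mathbb{R}^n$ is in its kernel.) -/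

import Mathlib

open MeasureTheory ProbabilityTheory
open scoped Matrix

/-- The `s`-sparse vectors of `ℝⁿ`: those with at most `s` nonzero coordinates
(`s` is a real number, so no rounding is needed). -/
def sparseVectors (n : ℕ) (s : ℝ) : Set (EuclideanSpace ℝ (Fin n)) :=
  {y | ({i | y i ≠ 0}.ncard : ℝ) ≤ s}

/-- `Comp n δ ρ`: the `(δ, ρ)`-compressible vectors, i.e. the unit vectors of `ℝⁿ` at Euclidean
distance at most `ρ` from the set of `δ n`-sparse vectors. For `0 ≤ δ` this set contains `0`, so
`Metric.infDist` is the actual distance. -/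
def Comp (n : ℕ) (δ ρ : ℝ) : Set (EuclideanSpace ℝ (Fin n)) :=
  {x | ‖x‖ = 1 ∧ Metric.infDist x (sparseVectors n (δ * n)) ≤ ρ}

/-- `KernelsCompressible k δ ρ A`: for every `(n - k) × n` submatrix of the `n × n` matrix `A`
(given by a set `S` of `n - k` rows), every unit vector in the right kernel of that submatrix is
`(δ, ρ)`-compressible. -/
def KernelsCompressible {n : ℕ} (k : ℕ) (δ ρ : ℝ) (A : Matrix (Fin n) (Fin n) ℝ) : Prop :=
  ∀ S : Finset (Fin n), S.card + k = n →
    ∀ x : EuclideanSpace ℝ (Fin n), ‖x‖ = 1 →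
      A.submatrix (fun i : S => (i : Fin n)) id *ᵥ x.ofLp = 0 → x ∈ Comp n δ ρ

/-- `IsBernoulliMatrix p M P`: under `P`, the entries of the random matrix `M` are independent
and each of them is `Ber(p)`, i.e. equal to `1` with probability `p` and to `0` with
probability `1 - p`. -/
structure IsBernoulliMatrix {Ω : Type*} [MeasurableSpace Ω] {n : ℕ} (p : unitInterval)
    (M : Ω → Matrix (Fin n) (Fin n) ℝ) (P : Measure Ω) : Prop where
  hasLaw : ∀ i j, HasLaw (fun ω => M ω i j) (bernoulliMeasure (1 : ℝ) 0 p) P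
  indep : iIndepFun (fun (ij : Fin n × Fin n) ω => M ω ij.1 ij.2) P

/-!
The kernel of an `(n - k) × n` submatrix has dimension at least `k`, so when all its unit vectors
are compressible it contains `k` unit vectors lying, up to a small error, in a net of sparse
lattice vectors. Once `ρ` is fixed, the size of this net is at most `(1 + θ) ^ n` with `θ` as small
as desired, by the choice of `δ`. The bound `(1 - p + ε) ^ (k n)` follows by a union bound over
this net, once a single row is known to be almost orthogonal to all vectors of a net tuple with
probability at most `(1 - p) ^ k`, because the rows are independent.

*One row* (`exists_robust_tuple`). The `k` vectors may be chosen freely in the kernel. If every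
unit vector of the kernel has a large coordinate, Gaussian elimination yields a triangular system
with large pivots (`exists_triangular_system`), and revealing the pivot bits last gains a factor
`1 - p` for each form (`coinExp_triangular_le`). Otherwise some unit vector has only small
coordinates, and Gaussian smoothing of its Bernoulli sum gives a small ball probability as small
as desired (`exists_light_smallBall`), so that this vector alone suffices. Both alternatives
survive small perturbations and arbitrary shifts.

*Passing to the net* (`exists_rowTube`). The matrix itself has operator norm of order `n`, but
after subtracting the mean the norm is `O(√n)` outside an event of probability at most
`(1 - p) ^ (k n)` (`exists_centredNorm_bound`), so replacing a kernel vector by a net vector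
disturbs the centred part noticeably on a small proportion of the rows only. The mean adds the
same number to each row; its rounded value is part of the net, at a polynomial cost.

*Counting.* Net size (`card_latticePoints_le`) and exceptional rows (`matExp_few_exceptions_le`)
are both bounded through generating functions, which avoids binomial estimates. For bounded `n` the
event is empty when `δ` is small, since then `δ n < 1`.

All probabilities are finite weighted sums over bit matrices;
`IsBernoulliMatrix.measureReal_le_matExp` reduces the general probability space to these.
-/

/-! ### Finite product Bernoulli measures -/

/-- The mass that `Ber(p)` gives to a bit, `true` standing for `1` and `false` for `0`. -/
def coinMass (p : ℝ) (b : Bool) : ℝ := if b then p else 1 - p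

/-- The value of a bit as a real number. -/
def bitVal (b : Bool) : ℝ := if b then 1 else 0

/-- Expectation of `f` over independent `Ber(p)` bits indexed by `ι`, as a finite weighted sum. -/
noncomputable def coinExp {ι : Type*} [Fintype ι] [DecidableEq ι] (p : ℝ)
    (f : (ι → Bool) → ℝ) : ℝ :=
  ∑ b : ι → Bool, (∏ i, coinMass p (b i)) * f b

/-- Expectation of `f` over an `n × n` matrix of independent `Ber(p)` bits, written row by row. -/
noncomputable def matExp {n : ℕ} (p : ℝ) (f : (Fin n → Fin n → Bool) → ℝ) : ℝ :=
  ∑ m : Fin n → Fin n → Bool, (∏ i, ∏ j, coinMass p (m i j)) * f m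

section Coin

variable {ι : Type*} [Fintype ι] [DecidableEq ι] {p : ℝ}

lemma coinMass_nonneg (h0 : 0 ≤ p) (h1 : p ≤ 1) (b : Bool) : 0 ≤ coinMass p b := by
  unfold coinMass; split_ifs <;> linarith

lemma sum_coinMass_mul (g : Bool → ℝ) :
    ∑ b, coinMass p b * g b = p * g true + (1 - p) * g false := by
  simp [coinMass]

lemma coinExp_prod (g : ι → Bool → ℝ) :
    coinExp p (fun b => ∏ i, g i (b i)) = ∏ i, (p * g i true + (1 - p) * g i false) := by
  simp_rw [coinExp, ← Finset.prod_mul_distrib, ← sum_coinMass_mul]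
  exact (Fintype.prod_sum fun i b => coinMass p b * g i b).symm

lemma coinExp_const (c : ℝ) : coinExp p (fun _ : ι → Bool => c) = c := by
  have h := coinExp_prod (ι := ι) (p := p) (fun _ _ => 1)
  simp only [coinExp, Finset.prod_const_one, mul_one, add_sub_cancel] at h
  rw [coinExp, ← Finset.sum_mul, h, one_mul]

lemma coinExp_mono (h0 : 0 ≤ p) (h1 : p ≤ 1) {f g : (ι → Bool) → ℝ} (h : ∀ b, f b ≤ g b) :
    coinExp p f ≤ coinExp p g :=
  Finset.sum_le_sum fun b _ => mul_le_mul_of_nonneg_left (h b)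
    (Finset.prod_nonneg fun _ _ => coinMass_nonneg h0 h1 _)

lemma coinExp_const_mul (c : ℝ) (f : (ι → Bool) → ℝ) :
    coinExp p (fun b => c * f b) = c * coinExp p f := by
  simp_rw [coinExp, Finset.mul_sum]
  exact Finset.sum_congr rfl fun _ _ => by ring

lemma coinExp_add (f g : (ι → Bool) → ℝ) :
    coinExp p (fun b => f b + g b) = coinExp p f + coinExp p g := by
  simp_rw [coinExp, mul_add, Finset.sum_add_distrib]

/-- Resampling a single bit does not change expectations. -/
lemma coinExp_resample (j : ι) (f : (ι → Bool) → ℝ) :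
    coinExp p f = coinExp p fun b =>
      p * f (Function.update b j true) + (1 - p) * f (Function.update b j false) := by
  have key : ∀ g : (ι → Bool) → ℝ, coinExp p g =
      ∑ b' : {i // i ≠ j} → Bool, (∏ i, coinMass p (b' i)) *
        (p * g ((Equiv.funSplitAt j Bool).symm (true, b')) +
          (1 - p) * g ((Equiv.funSplitAt j Bool).symm (false, b'))) := by
    intro g
    have hw : ∀ c b', ∏ i, coinMass p ((Equiv.funSplitAt j Bool).symm (c, b') i) =
        coinMass p c * ∏ i, coinMass p (b' i) := by
      intro c b'
      rw [Fintype.prod_eq_mul_prod_subtype_ne _ j]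
      congr 1
      · simp [Equiv.funSplitAt, Equiv.piSplitAt]
      · exact Finset.prod_congr rfl fun i _ => by
          simp [Equiv.funSplitAt, Equiv.piSplitAt, i.2]
    rw [coinExp, ← (Equiv.funSplitAt j Bool).symm.sum_comp, Fintype.sum_prod_type_right]
    refine Finset.sum_congr rfl fun b' _ => ?_
    rw [Fintype.sum_bool, hw, hw]
    simp only [coinMass, if_true, Bool.false_eq_true, if_false]
    ring
  have hu : ∀ c c' b', Function.update ((Equiv.funSplitAt j Bool).symm (c, b')) j c' =
      (Equiv.funSplitAt j Bool).symm (c', b') := by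
    intro c c' b'
    ext i
    by_cases h : i = j
    · subst h; simp [Equiv.funSplitAt, Equiv.piSplitAt]
    · simp [Equiv.funSplitAt, Equiv.piSplitAt, h]
  rw [key, key]
  simp only [hu]
  exact Finset.sum_congr rfl fun b' _ => by ring

end Coin

section Mat

variable {n : ℕ} {p : ℝ}

lemma matExp_mono (h0 : 0 ≤ p) (h1 : p ≤ 1) {f g : (Fin n → Fin n → Bool) → ℝ}
    (h : ∀ m, f m ≤ g m) : matExp p f ≤ matExp p g :=
  Finset.sum_le_sum fun m _ => mul_le_mul_of_nonneg_left (h m)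
    (Finset.prod_nonneg fun _ _ => Finset.prod_nonneg fun _ _ => coinMass_nonneg h0 h1 _)

lemma matExp_const_mul (c : ℝ) (f : (Fin n → Fin n → Bool) → ℝ) :
    matExp p (fun m => c * f m) = c * matExp p f := by
  simp_rw [matExp, Finset.mul_sum]
  exact Finset.sum_congr rfl fun _ _ => by ring

lemma matExp_add (f g : (Fin n → Fin n → Bool) → ℝ) :
    matExp p (fun m => f m + g m) = matExp p f + matExp p g := by
  simp_rw [matExp, mul_add, Finset.sum_add_distrib]

lemma matExp_sum {κ : Type*} (s : Finset κ) (f : κ → (Fin n → Fin n → Bool) → ℝ) :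
    matExp p (fun m => ∑ a ∈ s, f a m) = ∑ a ∈ s, matExp p (f a) := by
  simp_rw [matExp, Finset.mul_sum]
  rw [Finset.sum_comm]

/-- The rows of the random matrix are independent. -/
lemma matExp_prod_rows (g : Fin n → (Fin n → Bool) → ℝ) :
    matExp p (fun m => ∏ i, g i (m i)) = ∏ i, coinExp p (g i) := by
  simp_rw [matExp, coinExp, ← Finset.prod_mul_distrib]
  exact (Fintype.prod_sum fun i b => (∏ j, coinMass p (b j)) * g i b).symm

end Mat

/-- The law of a Bernoulli random matrix is the finite product law: the probability of any event
(measurable or not) is at most the corresponding weighted count of bit matrices. -/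
lemma IsBernoulliMatrix.measureReal_le_matExp {Ω : Type*} [MeasurableSpace Ω] {P : Measure Ω}
    [IsProbabilityMeasure P] {n : ℕ} {p : unitInterval} {M : Ω → Matrix (Fin n) (Fin n) ℝ}
    (hM : IsBernoulliMatrix p M P) (E : Set (Matrix (Fin n) (Fin n) ℝ)) :
    P.real {ω | M ω ∈ E} ≤
      matExp p ({m | Matrix.of (fun i j => bitVal (m i j)) ∈ E}.indicator 1) := by
  classical
  set B : (Fin n → Fin n → Bool) → Matrix (Fin n) (Fin n) ℝ :=
    fun m => Matrix.of (fun i j => bitVal (m i j)) with hB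
  have hbit : ∀ i j (b : Bool), P.real {ω | M ω i j = bitVal b} = coinMass p b := by
    intro i j b
    have h := (hM.hasLaw i j).measureReal_eq (p := fun x => x = bitVal b)
      (measurableSet_singleton (bitVal b))
    rw [h, bernoulliMeasure_real_apply _ (by exact measurableSet_singleton (bitVal b))]
    cases b <;> simp [bitVal, coinMass]
  have hnull : P {ω | ∃ i j, M ω i j ≠ 0 ∧ M ω i j ≠ 1} = 0 := by
    have : {ω | ∃ i j, M ω i j ≠ 0 ∧ M ω i j ≠ 1} =
        ⋃ i, ⋃ j, {ω | M ω i j ≠ 0 ∧ M ω i j ≠ 1} := by ext; simp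
    rw [this, measure_iUnion_null_iff]
    intro i
    rw [measure_iUnion_null_iff]
    intro j
    have hms : MeasurableSet {x : ℝ | x ≠ 0 ∧ x ≠ 1} :=
      ((measurableSet_singleton (0 : ℝ)).compl.inter (measurableSet_singleton (1 : ℝ)).compl)
    have h := (hM.hasLaw i j).measure_eq (p := fun x => x ≠ 0 ∧ x ≠ 1) hms
    rw [h, bernoulliMeasure_apply _ hms]
    simp
  have hpoint : ∀ m, P.real {ω | M ω = B m} = ∏ i, ∏ j, coinMass p (m i j) := by
    intro m
    have hset : {ω | M ω = B m} =
        ⋂ ij ∈ (Finset.univ : Finset (Fin n × Fin n)),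
          (fun ω => M ω ij.1 ij.2) ⁻¹' {bitVal (m ij.1 ij.2)} := by
      ext ω
      simp only [Set.mem_ofPred_eq, Finset.mem_univ, Set.iInter_true, Set.mem_iInter,
        Set.mem_preimage, Set.mem_singleton_iff, Prod.forall]
      exact ⟨fun h i j => by rw [h]; rfl, fun h => by ext i j; exact h i j⟩
    have h := hM.indep.measure_inter_preimage_eq_mul Finset.univ
      (sets := fun ij => {bitVal (m ij.1 ij.2)}) (fun _ _ => measurableSet_singleton _)
    rw [measureReal_def, hset, h, ENNReal.toReal_prod, Fintype.prod_prod_type]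
    refine Finset.prod_congr rfl fun i _ => Finset.prod_congr rfl fun j _ => ?_
    exact hbit i j (m i j)
  have hsub : {ω | M ω ∈ E} ⊆ (⋃ m ∈ Finset.univ.filter (fun m => B m ∈ E), {ω | M ω = B m}) ∪
      {ω | ∃ i j, M ω i j ≠ 0 ∧ M ω i j ≠ 1} := by
    intro ω hω
    by_cases h : ∃ i j, M ω i j ≠ 0 ∧ M ω i j ≠ 1
    · exact Or.inr h
    · push Not at h
      have hMB : M ω = B (fun i j => decide (M ω i j = 1)) := by
        ext i j
        by_cases h0 : M ω i j = 0
        · simp [hB, bitVal, h0]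
        · simp [hB, bitVal, h i j h0]
      refine Or.inl ?_
      simp only [Set.mem_iUnion]
      refine ⟨_, ?_, hMB⟩
      simp only [Finset.mem_filter, Finset.mem_univ, true_and]
      rw [← hMB]; exact hω
  calc P.real {ω | M ω ∈ E}
      ≤ P.real ((⋃ m ∈ Finset.univ.filter (fun m => B m ∈ E), {ω | M ω = B m}) ∪
          {ω | ∃ i j, M ω i j ≠ 0 ∧ M ω i j ≠ 1}) := measureReal_mono hsub
    _ ≤ P.real (⋃ m ∈ Finset.univ.filter (fun m => B m ∈ E), {ω | M ω = B m}) +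
          P.real {ω | ∃ i j, M ω i j ≠ 0 ∧ M ω i j ≠ 1} := measureReal_union_le _ _
    _ = P.real (⋃ m ∈ Finset.univ.filter (fun m => B m ∈ E), {ω | M ω = B m}) := by
        rw [measureReal_def P {ω | ∃ i j, M ω i j ≠ 0 ∧ M ω i j ≠ 1}, hnull]; simp
    _ ≤ ∑ m ∈ Finset.univ.filter (fun m => B m ∈ E), P.real {ω | M ω = B m} :=
        measureReal_biUnion_finset_le _ _
    _ = _ := by
        simp only [hpoint, matExp, Set.indicator_apply, Set.mem_ofPred_eq, Pi.one_apply, mul_ite,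
          mul_one, mul_zero, Finset.sum_filter]
        rfl

/-! ### Small ball probabilities of a single row -/

section Triangular

variable {ι : Type*} [Fintype ι] [DecidableEq ι] {p : ℝ}

lemma sum_bitVal_update (b : ι → Bool) (y : ι → ℝ) (j : ι) (v : Bool) :
    ∑ a, bitVal (Function.update b j v a) * y a =
      bitVal v * y j + ∑ a ∈ Finset.univ.erase j, bitVal (b a) * y a := by
  rw [← Finset.add_sum_erase _ _ (Finset.mem_univ j), Function.update_self]
  congr 1
  refine Finset.sum_congr rfl fun a ha => ?_
  rw [Function.update_of_ne (Finset.ne_of_mem_erase ha)]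

/-- A triangular system of `d` linear forms, each with a pivot coefficient exceeding `2c`, lies in
a given cube of half-side `c` with probability at most `(1 - p) ^ d`: once the other bits are
revealed, each form in turn leaves at most one admissible value of its pivot bit. -/
lemma coinExp_triangular_le (h0 : 0 ≤ p) (h1 : p ≤ 1 / 2) {c : ℝ} {d : ℕ} (y : Fin d → ι → ℝ)
    (j : Fin d → ι) (t : Fin d → ℝ) (hbig : ∀ i, 2 * c < |y i (j i)|)
    (hzero : ∀ i l, l < i → y i (j l) = 0) :
    coinExp p ({b | ∀ i, |∑ a, bitVal (b a) * y i a + t i| ≤ c}.indicator 1) ≤ (1 - p) ^ d := by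
  induction d with
  | zero =>
    refine (coinExp_mono h0 (by linarith) (g := fun _ => 1) fun b => ?_).trans ?_
    · exact Set.indicator_le_self' (fun _ _ => zero_le_one) b
    · rw [coinExp_const, pow_zero]
  | succ d ih =>
    have ih' := ih (fun i => y i.succ) (fun i => j i.succ) (fun i => t i.succ)
      (fun i => hbig _) (fun i l hl => hzero _ _ (Fin.succ_lt_succ_iff.2 hl))
    set E' : Set (ι → Bool) :=
      {b | ∀ i : Fin d, |∑ a, bitVal (b a) * y i.succ a + t i.succ| ≤ c} with hE'
    set E : Set (ι → Bool) := {b | ∀ i, |∑ a, bitVal (b a) * y i a + t i| ≤ c} with hE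
    have hinv : ∀ b v, Function.update b (j 0) v ∈ E' ↔ b ∈ E' := by
      intro b v
      simp only [hE', Set.mem_ofPred_eq]
      refine forall_congr' fun i => ?_
      have hz := hzero i.succ 0 (Fin.succ_pos i)
      rw [sum_bitVal_update, hz, ← Finset.add_sum_erase _ _ (Finset.mem_univ (j 0)), hz,
        mul_zero, mul_zero]
    have hsub : ∀ b, b ∈ E → b ∈ E' := fun b hb i => hb i.succ
    have hnot : ∀ b, ¬ (Function.update b (j 0) true ∈ E ∧ Function.update b (j 0) false ∈ E) := by
      rintro b ⟨ht, hf⟩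
      have ht := ht 0
      have hf := hf 0
      rw [sum_bitVal_update] at ht hf
      have hb := hbig 0
      simp only [bitVal, if_true, Bool.false_eq_true, if_false, one_mul, zero_mul, zero_add]
        at ht hf
      rw [abs_le] at ht hf
      rcases lt_abs.1 hb with h | h <;> linarith
    calc coinExp p (E.indicator 1)
        = coinExp p fun b => p * E.indicator 1 (Function.update b (j 0) true) +
            (1 - p) * E.indicator 1 (Function.update b (j 0) false) := coinExp_resample _ _
      _ ≤ coinExp p fun b => (1 - p) * E'.indicator 1 b := by
          refine coinExp_mono h0 (by linarith) fun b => ?_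
          by_cases hb : b ∈ E'
          · have := hnot b
            by_cases hT : Function.update b (j 0) true ∈ E
            · have hF : Function.update b (j 0) false ∉ E := fun h => this ⟨hT, h⟩
              simp only [Set.indicator_of_mem hT, Set.indicator_of_notMem hF,
                Set.indicator_of_mem hb, Pi.one_apply]
              linarith
            · by_cases hF : Function.update b (j 0) false ∈ E <;>
                simp only [hT, hF, hb, Set.indicator_of_mem, Set.indicator_of_notMem,
                  not_false_iff, Pi.one_apply] <;> linarith
          · have hT : Function.update b (j 0) true ∉ E := fun h => hb ((hinv b _).1 (hsub _ h))
            have hF : Function.update b (j 0) false ∉ E := fun h => hb ((hinv b _).1 (hsub _ h))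
            simp [hT, hF, hb]
      _ = (1 - p) * coinExp p (E'.indicator 1) := coinExp_const_mul _ _
      _ ≤ (1 - p) * (1 - p) ^ d := mul_le_mul_of_nonneg_left ih' (by linarith)
      _ = (1 - p) ^ (d + 1) := (pow_succ' _ _).symm

end Triangular

section Light

lemma norm_bernoulli_charFun_le {p : ℝ} (h0 : 0 ≤ p) (h1 : p ≤ 1) (θ : ℝ) :
    ‖(p : ℂ) * Complex.exp (θ * Complex.I) + (1 - p)‖ ≤ 1 := by
  calc _ ≤ ‖(p : ℂ) * Complex.exp (θ * Complex.I)‖ + ‖((1 - p : ℝ) : ℂ)‖ := by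
        push_cast; exact norm_add_le _ _
    _ = 1 := by
        rw [norm_mul, Complex.norm_exp_ofReal_mul_I, Complex.norm_real, Complex.norm_real,
          Real.norm_of_nonneg h0, Real.norm_of_nonneg (by linarith)]
        ring

lemma norm_bernoulli_charFun_le_exp {p : ℝ} (h0 : 0 ≤ p) (h1 : p ≤ 1) {θ : ℝ}
    (hθ : |θ| ≤ Real.pi) :
    ‖(p : ℂ) * Complex.exp (θ * Complex.I) + (1 - p)‖ ≤
      Real.exp (-(2 * p * (1 - p) / Real.pi ^ 2 * θ ^ 2)) := by
  have hsq : ‖(p : ℂ) * Complex.exp (θ * Complex.I) + (1 - p)‖ ^ 2 =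
      1 - 2 * p * (1 - p) * (1 - Real.cos θ) := by
    have : (p : ℂ) * Complex.exp (θ * Complex.I) + (1 - p) =
        ((p * Real.cos θ + (1 - p) : ℝ) : ℂ) + ((p * Real.sin θ : ℝ) : ℂ) * Complex.I := by
      rw [Complex.exp_mul_I]; push_cast; ring
    rw [this, ← Complex.normSq_eq_norm_sq, Complex.normSq_add_mul_I]
    linear_combination p ^ 2 * Real.sin_sq_add_cos_sq θ
  have hcos := Real.cos_le_one_sub_mul_cos_sq hθ
  refine (sq_le_sq₀ (norm_nonneg _) (Real.exp_nonneg _)).1 ?_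
  rw [hsq, ← Real.exp_nat_mul]
  refine le_trans ?_ (Real.add_one_le_exp _)
  have hp : 0 ≤ 2 * p * (1 - p) := by nlinarith
  have := mul_le_mul_of_nonneg_left (show 2 / Real.pi ^ 2 * θ ^ 2 ≤ 1 - Real.cos θ by linarith) hp
  push_cast
  have e : (2 : ℝ) * -(2 * p * (1 - p) / Real.pi ^ 2 * θ ^ 2) =
    -(2 * p * (1 - p) * (2 / Real.pi ^ 2 * θ ^ 2)) := by ring
  linarith

lemma integral_exp_neg_mul_sq_gaussianReal_le {β : ℝ} (hβ : 0 < β) :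
    ∫ x, Real.exp (-β * x ^ 2) ∂(gaussianReal 0 1) ≤ √(Real.pi / β) := by
  rw [integral_gaussianReal_eq_integral_smul one_ne_zero, ← integral_gaussian]
  refine integral_mono_of_nonneg (Filter.Eventually.of_forall fun x => ?_)
    (integrable_exp_neg_mul_sq hβ) (Filter.Eventually.of_forall fun x => ?_)
  · exact mul_nonneg (gaussianPDFReal_nonneg _ _ _) (Real.exp_nonneg _)
  · refine mul_le_of_le_one_left (Real.exp_nonneg _) ?_
    rw [gaussianPDFReal_def]
    refine mul_le_one₀ (inv_le_one_of_one_le₀ ?_) (Real.exp_nonneg _) ?_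
    · rw [Real.one_le_sqrt]
      have := Real.pi_gt_three
      push_cast; linarith
    · exact Real.exp_le_one_iff.2 (by
        rw [neg_div]; exact neg_nonpos.2 (by positivity))

/-- Esseen's smoothing inequality with a Gaussian kernel, for a Bernoulli sum: the concentration at
scale `c` is at most an average of the modulus of the characteristic function at scale `1 / c`. -/
lemma coinExp_smallBall_le_integral {n : ℕ} {p c : ℝ} (h0 : 0 ≤ p) (h1 : p ≤ 1) (hc : 0 < c)
    (y : Fin n → ℝ) (t : ℝ) :
    coinExp p ({b | |∑ a, bitVal (b a) * y a + t| ≤ c}.indicator 1) ≤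
      2 * ∫ x, ∏ a, ‖(p : ℂ) * Complex.exp ((x / c * y a : ℝ) * Complex.I) + (1 - p)‖
        ∂(gaussianReal 0 1) := by
  set X : (Fin n → Bool) → ℝ := fun b => ∑ a, bitVal (b a) * y a + t with hX
  have hstep : coinExp p ({b | |X b| ≤ c}.indicator 1) ≤
      2 * coinExp p fun b => Real.exp (-(X b / c) ^ 2 / 2) := by
    rw [← coinExp_const_mul]
    refine coinExp_mono h0 h1 fun b => ?_
    by_cases hb : b ∈ {b | |X b| ≤ c}
    · rw [Set.indicator_of_mem hb, Pi.one_apply]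
      have h2 : (X b / c) ^ 2 ≤ 1 := by
        rw [sq_le_one_iff_abs_le_one, abs_div, abs_of_pos hc]
        exact (div_le_one hc).2 hb
      have := Real.add_one_le_exp (-(X b / c) ^ 2 / 2)
      linarith
    · rw [Set.indicator_of_notMem hb]; positivity
  refine hstep.trans (mul_le_mul_of_nonneg_left ?_ zero_le_two)
  have hchar : ∀ b, ((Real.exp (-(X b / c) ^ 2 / 2) : ℝ) : ℂ) =
      ∫ x, Complex.exp ((X b / c : ℝ) * x * Complex.I) ∂(gaussianReal 0 1) := by
    intro b
    rw [← charFun_apply_real, charFun_gaussianReal]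
    push_cast
    congr 1
    ring
  have hint : ∀ b, Integrable (fun x : ℝ => Complex.exp ((X b / c : ℝ) * x * Complex.I))
      (gaussianReal 0 1) := by
    intro b
    refine Integrable.of_bound (by fun_prop) 1 (Filter.Eventually.of_forall fun x => ?_)
    rw [← Complex.ofReal_mul, Complex.norm_exp_ofReal_mul_I]
  have hexp : ((coinExp p fun b => Real.exp (-(X b / c) ^ 2 / 2) : ℝ) : ℂ) =
      ∫ x : ℝ, Complex.exp ((x / c * t : ℝ) * Complex.I) *
        ∏ a, ((p : ℂ) * Complex.exp ((x / c * y a : ℝ) * Complex.I) + (1 - p))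
        ∂(gaussianReal 0 1) := by
    rw [coinExp, Complex.ofReal_sum]
    simp_rw [Complex.ofReal_mul _ (Real.exp _), Complex.ofReal_prod, hchar, ← integral_const_mul]
    rw [← integral_finsetSum _ fun b _ => (hint b).const_mul _]
    refine integral_congr_ae (Filter.Eventually.of_forall fun x => ?_)
    have hf : ∀ a, (p : ℂ) * Complex.exp ((x / c * y a : ℝ) * Complex.I) + (1 - p) =
        ∑ v, (coinMass p v : ℂ) * Complex.exp ((x / c * (bitVal v * y a) : ℝ) * Complex.I) := by
      intro a; simp [coinMass, bitVal]
    simp only [hf]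
    rw [Fintype.prod_sum, Finset.mul_sum]
    refine Finset.sum_congr rfl fun b _ => ?_
    rw [Finset.prod_mul_distrib, ← Complex.exp_sum, mul_left_comm, ← Complex.exp_add]
    congr 2
    rw [← Finset.sum_mul, ← add_mul, ← Complex.ofReal_sum, ← Finset.mul_sum]
    simp only [hX]
    push_cast
    ring
  have hnn : 0 ≤ coinExp p fun b => Real.exp (-(X b / c) ^ 2 / 2) := by
    rw [← coinExp_const (ι := Fin n) (p := p) 0]
    exact coinExp_mono h0 h1 fun b => Real.exp_nonneg _
  rw [← Real.norm_of_nonneg hnn, ← Complex.norm_real, hexp]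
  refine (norm_integral_le_integral_norm _).trans (le_of_eq ?_)
  refine integral_congr_ae (Filter.Eventually.of_forall fun x => ?_)
  simp only [norm_mul, norm_prod, Complex.norm_exp_ofReal_mul_I, one_mul]

/-- Bernoulli sums with non-negligible `ℓ²` mass and only small coefficients are anti-concentrated:
the small ball probability can be made smaller than any `q > 0`. -/
lemma exists_light_smallBall {p q : ℝ} (h0 : 0 < p) (h1 : p < 1) (hq : 0 < q) :
    ∃ c > 0, ∃ τ > 0, ∀ (n : ℕ) (y : Fin n → ℝ) (t : ℝ), 1 / 4 ≤ ∑ a, y a ^ 2 →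
      (∀ a, |y a| ≤ 2 * τ) →
      coinExp p ({b | |∑ a, bitVal (b a) * y a + t| ≤ c}.indicator 1) ≤ q := by
  have hpi := Real.pi_pos
  have hp : 0 < p * (1 - p) := mul_pos h0 (by linarith)
  -- At frequency `x / c` the characteristic function is at most `exp (-α x ^ 2 / c ^ 2)`, which is
  -- `exp (-β x ^ 2)` by the choice of `c`, as long as `|x| ≤ R`; here `τ` keeps all the arguments
  -- `x / c * y a` below `π`. Both `β` and `R` are chosen to give a total of at most `q`.
  set α : ℝ := p * (1 - p) / (2 * Real.pi ^ 2) with hα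
  have hα0 : 0 < α := by positivity
  set β : ℝ := 16 * Real.pi / q ^ 2 with hβ
  have hβ0 : 0 < β := by positivity
  set R : ℝ := 1 + 4 / q with hR
  have hR0 : 0 < R := by positivity
  have hR2 : 4 / q ≤ R ^ 2 := by
    have : 0 < 4 / q := by positivity
    nlinarith
  set c : ℝ := √(α / β) with hc
  have hc0 : 0 < c := Real.sqrt_pos.2 (by positivity)
  have hc2 : c ^ 2 = α / β := Real.sq_sqrt (by positivity)
  refine ⟨c, hc0, Real.pi * c / R / 2, by positivity, fun n y t hy hsmall => ?_⟩
  refine (coinExp_smallBall_le_integral h0.le h1.le hc0 y t).trans ?_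
  have hsqint : Integrable (fun x : ℝ => x ^ 2) (gaussianReal 0 1) :=
    (memLp_id_gaussianReal 2).integrable_sq
  have hexpint : Integrable (fun x : ℝ => Real.exp (-β * x ^ 2)) (gaussianReal 0 1) := by
    refine Integrable.of_bound (by fun_prop) 1 (Filter.Eventually.of_forall fun x => ?_)
    rw [Real.norm_of_nonneg (Real.exp_nonneg _)]
    exact Real.exp_le_one_iff.2 (by nlinarith [sq_nonneg x])
  have hsq1 : ∫ x, x ^ 2 ∂(gaussianReal 0 1) = 1 := by
    have h := variance_fun_id_gaussianReal (μ := 0) (v := 1)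
    rw [variance_of_integral_eq_zero (by fun_prop) (by simp)] at h
    simpa using h
  have hbound : ∫ x, ∏ a, ‖(p : ℂ) * Complex.exp ((x / c * y a : ℝ) * Complex.I) + (1 - p)‖
      ∂(gaussianReal 0 1) ≤ ∫ x, (Real.exp (-β * x ^ 2) + x ^ 2 / R ^ 2) ∂(gaussianReal 0 1) := by
    refine integral_mono_of_nonneg (Filter.Eventually.of_forall fun x => by positivity)
      (hexpint.add (hsqint.div_const _)) (Filter.Eventually.of_forall fun x => ?_)
    by_cases hx : |x| ≤ R
    · have hθ : ∀ a, |x / c * y a| ≤ Real.pi := by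
        intro a
        rw [abs_mul, abs_div, abs_of_pos hc0]
        calc |x| / c * |y a| ≤ R / c * (2 * (Real.pi * c / R / 2)) :=
              mul_le_mul (by gcongr) (hsmall a) (abs_nonneg _) (by positivity)
          _ = Real.pi := by field_simp
      calc ∏ a, ‖(p : ℂ) * Complex.exp ((x / c * y a : ℝ) * Complex.I) + (1 - p)‖
          ≤ ∏ a, Real.exp (-(2 * p * (1 - p) / Real.pi ^ 2 * (x / c * y a) ^ 2)) :=
            Finset.prod_le_prod (fun _ _ => norm_nonneg _)
              fun a _ => norm_bernoulli_charFun_le_exp h0.le h1.le (hθ a)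
        _ = Real.exp (-(4 * α * (x / c) ^ 2 * ∑ a, y a ^ 2)) := by
            rw [← Real.exp_sum, Finset.sum_neg_distrib, Finset.mul_sum]
            congr 2
            refine Finset.sum_congr rfl fun a _ => ?_
            rw [hα]; field_simp; ring
        _ ≤ Real.exp (-β * x ^ 2) := by
            refine Real.exp_le_exp.2 ?_
            have e : β * x ^ 2 = α * (x / c) ^ 2 := by
              rw [div_pow, hc2]; field_simp
            have : 0 ≤ 4 * α * (x / c) ^ 2 := by positivity
            nlinarith [mul_le_mul_of_nonneg_left hy this]
        _ ≤ _ := le_add_of_nonneg_right (by positivity)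
    · push Not at hx
      have h3 : 1 ≤ x ^ 2 / R ^ 2 := by
        rw [one_le_div (by positivity), ← sq_abs x]
        gcongr
      calc _ ≤ (1 : ℝ) := Finset.prod_le_one (fun _ _ => norm_nonneg _)
            fun a _ => norm_bernoulli_charFun_le h0.le h1.le _
        _ ≤ _ := h3.trans (le_add_of_nonneg_left (Real.exp_nonneg _))
  have hval : ∫ x, (Real.exp (-β * x ^ 2) + x ^ 2 / R ^ 2) ∂(gaussianReal 0 1) ≤ q / 4 + q / 4 := by
    rw [integral_add hexpint (hsqint.div_const _), integral_div, hsq1]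
    refine add_le_add ((integral_exp_neg_mul_sq_gaussianReal_le hβ0).trans (le_of_eq ?_)) ?_
    · rw [show Real.pi / β = (q / 4) ^ 2 by rw [hβ]; field_simp; ring]
      exact Real.sqrt_sq (by positivity)
    · calc 1 / R ^ 2 ≤ 1 / (4 / q) := by gcongr
        _ = q / 4 := by field_simp
  linarith

end Light

/-! ### Robust tuples in subspaces of large dimension -/

/-- Gaussian elimination with large pivots: if every unit vector of `V` has a coordinate exceeding
`τ`, then `V` contains a triangular system of unit vectors whose pivots all exceed `τ`. -/
lemma exists_triangular_system {n : ℕ} {τ : ℝ} (d : ℕ) (V : Submodule ℝ (Fin n → ℝ))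
    (hd : d ≤ Module.finrank ℝ V) (hV : ∀ x ∈ V, ∑ a, x a ^ 2 = 1 → ∃ a, τ < |x a|) :
    ∃ (x : Fin d → Fin n → ℝ) (j : Fin d → Fin n), (∀ i, x i ∈ V) ∧ (∀ i, ∑ a, x i a ^ 2 = 1) ∧
      (∀ i, τ < |x i (j i)|) ∧ ∀ i l, l < i → x i (j l) = 0 := by
  induction d generalizing V with
  | zero =>
    exact ⟨fun i => i.elim0, fun i => i.elim0, fun i => i.elim0, fun i => i.elim0,
      fun i => i.elim0, fun i => i.elim0⟩
  | succ d ih =>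
    obtain ⟨x₀, hx₀V, hx₀⟩ : ∃ x ∈ V, ∑ a, x a ^ 2 = 1 := by
      have : 0 < Module.finrank ℝ V := by omega
      have : Nontrivial V := Module.finrank_pos_iff.1 this
      obtain ⟨⟨v, hvV⟩, hv⟩ := exists_ne (0 : V)
      have hv0 : v ≠ 0 := fun h => hv (by simp [h])
      have hpos : 0 < ∑ a, v a ^ 2 := by
        obtain ⟨a, ha⟩ := Function.ne_iff.1 hv0
        exact Finset.sum_pos' (fun _ _ => sq_nonneg _)
          ⟨a, Finset.mem_univ a, by have : v a ≠ 0 := ha; positivity⟩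
      refine ⟨(√(∑ a, v a ^ 2))⁻¹ • v, V.smul_mem _ hvV, ?_⟩
      simp only [Pi.smul_apply, smul_eq_mul, mul_pow, ← Finset.mul_sum, inv_pow,
        Real.sq_sqrt hpos.le]
      exact inv_mul_cancel₀ hpos.ne'
    obtain ⟨j₀, hj₀⟩ := hV x₀ hx₀V hx₀
    -- The vectors of `V` that vanish at the pivot `j₀` form a subspace of codimension at most one.
    set φ : (Fin n → ℝ) →ₗ[ℝ] ℝ := LinearMap.proj j₀
    have hdim : d ≤ Module.finrank ℝ (V ⊓ LinearMap.ker φ : Submodule ℝ (Fin n → ℝ)) := by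
      have h1 := Submodule.finrank_sup_add_finrank_inf_eq V (LinearMap.ker φ)
      have h2 := φ.finrank_range_add_finrank_ker
      have h3 : Module.finrank ℝ (LinearMap.range φ) ≤ 1 := by
        simpa using Submodule.finrank_le (LinearMap.range φ)
      have h4 := Submodule.finrank_le (V ⊔ LinearMap.ker φ)
      omega
    obtain ⟨x, j, hxV, hx, hbig, hzero⟩ := ih (V ⊓ LinearMap.ker φ) hdim
      (fun x hx => hV x hx.1)
    refine ⟨Fin.cons x₀ x, Fin.cons j₀ j, ?_, ?_, ?_, ?_⟩
    · exact Fin.cases (by simpa using hx₀V) fun i => by simpa using (hxV i).1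
    · exact Fin.cases (by simpa using hx₀) fun i => by simpa using hx i
    · exact Fin.cases (by simpa using hj₀) fun i => by simpa using hbig i
    · intro i l hl
      induction i using Fin.cases with
      | zero => exact absurd hl (Fin.not_lt_zero l)
      | succ i =>
        induction l using Fin.cases with
        | zero => simpa [φ] using (hxV i).2
        | succ l => simpa using hzero i l (Fin.succ_lt_succ_iff.1 hl)

/-- A subspace of dimension at least `k` contains `k` unit vectors, every small perturbation of
which (keeping zero coordinates zero) is hit by a Bernoulli row, in a cube of constant size, with
probability at most `(1 - p) ^ k`. Either some unit vector has only small coordinates, and it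
alone suffices, or there is a triangular system with large pivots. -/
lemma exists_robust_tuple {p : ℝ} (h0 : 0 < p) (h1 : p ≤ 1 / 2) {k : ℕ} (hk : 1 ≤ k) :
    ∃ c > 0, ∃ τ > 0, ∀ (n : ℕ) (V : Submodule ℝ (Fin n → ℝ)), k ≤ Module.finrank ℝ V →
      ∃ x : Fin k → Fin n → ℝ, (∀ i, x i ∈ V) ∧ (∀ i, ∑ a, x i a ^ 2 = 1) ∧
        ∀ (y : Fin k → Fin n → ℝ) (t : Fin k → ℝ), (∀ i, ∑ a, (x i a - y i a) ^ 2 ≤ τ ^ 2) →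
          (∀ i a, x i a = 0 → y i a = 0) →
          coinExp p ({b | ∀ i, |∑ a, bitVal (b a) * y i a + t i| ≤ c}.indicator 1) ≤
            (1 - p) ^ k := by
  obtain ⟨c₀, hc₀, τ₀, hτ₀, hlight⟩ := exists_light_smallBall h0 (by linarith)
    (show (0 : ℝ) < (1 - p) ^ k from pow_pos (by linarith) k)
  refine ⟨min c₀ (τ₀ / 4), by positivity, min (τ₀ / 2) (1 / 2), by positivity, fun n V hV => ?_⟩
  set τ := min (τ₀ / 2) (1 / 2) with hτ
  have hτpos : 0 < τ := by positivity
  have hτ1 : τ ≤ τ₀ / 2 := min_le_left _ _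
  have hτ2 : τ ≤ 1 / 2 := min_le_right _ _
  have hcoord : ∀ x y : Fin n → ℝ, ∑ a, (x a - y a) ^ 2 ≤ τ ^ 2 → ∀ a, |x a - y a| ≤ τ := by
    intro x y hxy a
    refine abs_le_of_sq_le_sq (le_trans ?_ hxy) hτpos.le
    exact Finset.single_le_sum (f := fun a => (x a - y a) ^ 2) (fun _ _ => sq_nonneg _)
      (Finset.mem_univ a)
  by_cases hV' : ∀ x ∈ V, ∑ a, x a ^ 2 = 1 → ∃ a, τ₀ < |x a|
  · obtain ⟨x, j, hxV, hx, hbig, hzero⟩ := exists_triangular_system k V hV hV'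
    refine ⟨x, hxV, hx, fun y t hy hy0 => ?_⟩
    refine coinExp_triangular_le h0.le h1 y j t (fun i => ?_)
      (fun i l hl => hy0 _ _ (hzero i l hl))
    have ha := hcoord _ _ (hy i) (j i)
    have hb := hbig i
    have hc := min_le_right c₀ (τ₀ / 4)
    have := abs_sub_abs_le_abs_sub (x i (j i)) (y i (j i))
    linarith
  · push Not at hV'
    obtain ⟨x, hxV, hx, hsmall⟩ := hV'
    refine ⟨fun _ => x, fun _ => hxV, fun _ => hx, fun y t hy _ => ?_⟩
    set i₀ : Fin k := ⟨0, hk⟩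
    refine le_trans (coinExp_mono h0.le (by linarith) fun b => ?_)
      (hlight n (y i₀) (t i₀) ?_ fun a => ?_)
    · refine Set.indicator_le_indicator_of_subset (fun b hb => ?_) (fun _ => zero_le_one) b
      exact (hb i₀).trans (min_le_left _ _)
    · have h := hy i₀
      have : ∑ a, x a ^ 2 ≤ ∑ a, (2 * y i₀ a ^ 2 + 2 * (x a - y i₀ a) ^ 2) :=
        Finset.sum_le_sum fun a _ => by nlinarith [sq_nonneg (x a - 2 * y i₀ a)]
      rw [hx, Finset.sum_add_distrib, ← Finset.mul_sum, ← Finset.mul_sum] at this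
      nlinarith
    · have ha := hcoord _ _ (hy i₀) a
      have := abs_sub_abs_le_abs_sub (y i₀ a) (x a)
      rw [abs_sub_comm (y i₀ a)] at this
      have := hsmall a
      linarith

/-! ### Lattice nets -/

/-- The integer vectors with at most `m` nonzero coordinates and squared Euclidean norm at most
`R`. The box serves only to make this visibly a finite set. -/
noncomputable def latticePoints (n : ℕ) (m R : ℝ) : Finset (Fin n → ℤ) := by
  classical
  exact (Fintype.piFinset fun _ => Finset.Icc (-⌈R⌉) ⌈R⌉).filter
    fun w => ((Finset.univ.filter fun a => w a ≠ 0).card : ℝ) ≤ m ∧ ∑ a, (w a : ℝ) ^ 2 ≤ R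

lemma mem_latticePoints {n : ℕ} {m R : ℝ} {w : Fin n → ℤ} :
    w ∈ latticePoints n m R ↔
      ((Finset.univ.filter fun a => w a ≠ 0).card : ℝ) ≤ m ∧ ∑ a, (w a : ℝ) ^ 2 ≤ R := by
  classical
  simp only [latticePoints, Finset.mem_filter, Fintype.mem_piFinset, Finset.mem_Icc,
    and_iff_right_iff_imp]
  rintro ⟨-, h⟩ a
  have h1 : (w a : ℝ) ^ 2 ≤ R := le_trans
    (Finset.single_le_sum (f := fun a => (w a : ℝ) ^ 2) (fun _ _ => sq_nonneg _)
      (Finset.mem_univ a)) h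
  have h2 : w a ^ 2 ≤ ⌈R⌉ := by
    have : ((w a ^ 2 : ℤ) : ℝ) ≤ (⌈R⌉ : ℤ) := by
      push_cast; exact h1.trans (Int.le_ceil R)
    exact_mod_cast this
  have h3 := Int.le_self_sq (w a)
  have h4 := Int.le_self_sq (-w a)
  constructor <;> nlinarith

lemma summable_exp_neg_mul_int_sq {s : ℝ} (hs : 0 < s) :
    Summable fun w : ℤ => Real.exp (-(s * (w : ℝ) ^ 2)) := by
  have h := summable_pow_mul_jacobiTheta₂_term_bound 0 (T := s / Real.pi)
    (div_pos hs Real.pi_pos) 0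
  refine h.congr fun w => ?_
  rw [pow_zero, one_mul]
  congr 1
  have := Real.pi_pos.ne'
  field_simp
  ring

/-- A Chernoff-type count of lattice points, from the generating function
`∑ v, exp (-u * [v ≠ 0] - s * v ^ 2)` of one coordinate. -/
lemma card_latticePoints_le {s u : ℝ} (hs : 0 < s) (hu : 0 ≤ u) (n : ℕ) (m R : ℝ) :
    ((latticePoints n m R).card : ℝ) ≤ Real.exp (u * m + s * R) *
      (1 + Real.exp (-u) * ∑' w : ℤ, Real.exp (-(s * (w : ℝ) ^ 2))) ^ n := by
  classical
  set g : ℤ → ℝ := fun v => Real.exp (-(u * if v = 0 then 0 else 1) - s * (v : ℝ) ^ 2) with hg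
  set B := Finset.Icc (-⌈R⌉) ⌈R⌉
  have hsum := summable_exp_neg_mul_int_sq hs
  have hB : ∑ v ∈ B, g v ≤
      1 + Real.exp (-u) * ∑' w : ℤ, Real.exp (-(s * (w : ℝ) ^ 2)) := by
    calc ∑ v ∈ B, g v ≤ ∑ v ∈ B, ((if v = 0 then 1 else 0) +
          Real.exp (-u) * Real.exp (-(s * (v : ℝ) ^ 2))) := by
          refine Finset.sum_le_sum fun v _ => ?_
          by_cases hv : v = 0
          · simp [hg, hv, Real.exp_nonneg]
          · simp [hg, hv, ← Real.exp_add, sub_eq_add_neg]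
      _ ≤ 1 + Real.exp (-u) * ∑' w : ℤ, Real.exp (-(s * (w : ℝ) ^ 2)) := by
          rw [Finset.sum_add_distrib, ← Finset.mul_sum]
          refine add_le_add ?_ (mul_le_mul_of_nonneg_left
            (hsum.sum_le_tsum _ fun _ _ => Real.exp_nonneg _) (Real.exp_nonneg _))
          rw [Finset.sum_ite_eq']
          split_ifs <;> norm_num
  calc ((latticePoints n m R).card : ℝ) = ∑ w ∈ latticePoints n m R, (1 : ℝ) := by simp
    _ ≤ ∑ w ∈ latticePoints n m R, Real.exp (u * m + s * R) * ∏ a, g (w a) := by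
        refine Finset.sum_le_sum fun w hw => ?_
        obtain ⟨h1, h2⟩ := mem_latticePoints.1 hw
        have hcard : ∑ a, (if w a = 0 then (0 : ℝ) else 1) =
            ((Finset.univ.filter fun a => w a ≠ 0).card : ℝ) := by
          simp [Finset.sum_ite]
        rw [← Real.exp_sum, ← Real.exp_add, Finset.sum_sub_distrib, Finset.sum_neg_distrib,
          ← Finset.mul_sum, ← Finset.mul_sum, hcard]
        refine Real.one_le_exp ?_
        nlinarith [mul_le_mul_of_nonneg_left h1 hu, mul_le_mul_of_nonneg_left h2 hs.le]
    _ ≤ ∑ w ∈ Fintype.piFinset fun _ : Fin n => B,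
          Real.exp (u * m + s * R) * ∏ a, g (w a) := by
        refine Finset.sum_le_sum_of_subset_of_nonneg (Finset.filter_subset _ _) fun _ _ _ => ?_
        exact mul_nonneg (Real.exp_nonneg _) (Finset.prod_nonneg fun _ _ => Real.exp_nonneg _)
    _ = Real.exp (u * m + s * R) * (∑ v ∈ B, g v) ^ n := by
        rw [← Finset.mul_sum, Finset.sum_pow']
    _ ≤ _ := by
        refine mul_le_mul_of_nonneg_left (pow_le_pow_left₀ ?_ hB n) (Real.exp_nonneg _)
        exact Finset.sum_nonneg fun _ _ => Real.exp_nonneg _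

lemma exists_int_abs_le (z : ℝ) : ∃ w : ℤ, |(w : ℝ)| ≤ |z| ∧ |z - w| ≤ 1 := by
  rcases le_total 0 z with hz | hz
  · refine ⟨⌊z⌋, ?_, ?_⟩
    · rw [abs_of_nonneg hz, abs_of_nonneg (by exact_mod_cast Int.floor_nonneg.2 hz)]
      exact Int.floor_le z
    · rw [abs_le]
      constructor <;> linarith [Int.floor_le z, Int.lt_floor_add_one z]
  · refine ⟨⌈z⌉, ?_, ?_⟩
    · have : (⌈z⌉ : ℝ) ≤ 0 := by exact_mod_cast Int.ceil_le.2 (by simpa using hz)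
      rw [abs_of_nonpos hz, abs_of_nonpos this]
      linarith [Int.le_ceil z]
    · rw [abs_le]
      constructor <;> linarith [Int.le_ceil z, Int.ceil_lt_add_one z]

/-- Rounding the coordinates in `I` towards zero on the lattice of mesh `r / √n`, and discarding
the others, costs at most `r ^ 2` in squared distance beyond the discarded mass. -/
lemma exists_lattice_rounding {n : ℕ} (hn : 0 < n) {r : ℝ} (hr : 0 < r) (x : Fin n → ℝ)
    (hx : ∑ a, x a ^ 2 ≤ 1) (I : Finset (Fin n)) :
    ∃ w ∈ latticePoints n I.card (n / r ^ 2), (∀ a, x a = 0 → w a = 0) ∧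
      ∑ a, (r / √n * w a) ^ 2 ≤ 1 ∧
      ∑ a, (x a - r / √n * w a) ^ 2 ≤ r ^ 2 + ∑ a ∈ Iᶜ, x a ^ 2 := by
  classical
  have hn' : (0 : ℝ) < n := by exact_mod_cast hn
  set h := r / √n with hh
  have hh0 : 0 < h := by positivity
  have hh2 : h ^ 2 = r ^ 2 / n := by rw [hh, div_pow, Real.sq_sqrt hn'.le]
  choose v hv1 hv2 using fun a => exists_int_abs_le (x a / h)
  have hle : ∀ a, (h * (if a ∈ I then v a else 0 : ℤ)) ^ 2 ≤ x a ^ 2 := by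
    intro a
    split_ifs
    · rw [sq_le_sq, abs_mul, abs_of_pos hh0]
      have := hv1 a
      rw [abs_div, abs_of_pos hh0, le_div_iff₀ hh0] at this
      linarith
    · simp [sq_nonneg]
  have hle1 : ∑ a, (h * (if a ∈ I then v a else 0 : ℤ)) ^ 2 ≤ 1 :=
    (Finset.sum_le_sum fun a _ => hle a).trans hx
  refine ⟨fun a => if a ∈ I then v a else 0, mem_latticePoints.2 ⟨?_, ?_⟩, ?_, hle1, ?_⟩
  · refine Nat.cast_le.2 (Finset.card_le_card fun a ha => ?_)
    simp only [Finset.mem_filter, Finset.mem_univ, true_and] at ha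
    by_contra hI
    exact ha (if_neg hI)
  · simp only [mul_pow, ← Finset.mul_sum, hh2] at hle1
    rw [le_div_iff₀ (by positivity)]
    have := mul_le_mul_of_nonneg_left hle1 hn'.le
    have e : ∀ S : ℝ, (n : ℝ) * (r ^ 2 / n * S) = S * r ^ 2 := by intro S; field_simp
    rw [e] at this
    linarith
  · intro a ha
    have h2 := hle a
    rw [ha, zero_pow two_ne_zero] at h2
    have h3 := pow_eq_zero_iff two_ne_zero |>.1 (le_antisymm h2 (sq_nonneg _))
    exact_mod_cast (mul_eq_zero.1 h3).resolve_left hh0.ne'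
  · rw [← Finset.sum_add_sum_compl I]
    refine add_le_add ?_ (le_of_eq (Finset.sum_congr rfl fun a ha => ?_))
    · calc ∑ a ∈ I, (x a - h * (if a ∈ I then v a else 0 : ℤ)) ^ 2 ≤ ∑ a ∈ I, h ^ 2 := by
            refine Finset.sum_le_sum fun a ha => ?_
            rw [if_pos ha]
            have e : x a - h * v a = h * (x a / h - v a) := by field_simp
            rw [e, mul_pow]
            exact mul_le_of_le_one_right (sq_nonneg _) ((sq_le_one_iff_abs_le_one _).2 (hv2 a))
        _ ≤ ∑ a : Fin n, h ^ 2 :=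
            Finset.sum_le_univ_sum_of_nonneg fun _ => sq_nonneg _
        _ = r ^ 2 := by
            rw [Finset.sum_const, Finset.card_univ, Fintype.card_fin, nsmul_eq_mul, hh2]
            field_simp
    · simp [Finset.mem_compl.1 ha]

/-! ### The operator norm of the centred matrix -/

/-- `CentredNormLE p K m`: the matrix of bits `m`, centred by subtracting `p` from every entry, has
Euclidean operator norm at most `K √n`. -/
def CentredNormLE {n : ℕ} (p K : ℝ) (m : Fin n → Fin n → Bool) : Prop :=
  ∀ z : Fin n → ℝ, ∑ i, (∑ j, (bitVal (m i j) - p) * z j) ^ 2 ≤ K ^ 2 * n * ∑ j, z j ^ 2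

/-- A bilinear form bounded on pairs of lattice vectors of mesh `1 / (4 √n)` in the unit ball is
bounded, up to a factor two, on all pairs of unit vectors. -/
lemma sum_sq_mulVec_le_of_lattice {n : ℕ} (hn : 0 < n) (B : Matrix (Fin n) (Fin n) ℝ) {C : ℝ}
    (hC : 0 ≤ C)
    (hB : ∀ w ∈ latticePoints n n (n / (1 / 4) ^ 2), ∀ w' ∈ latticePoints n n (n / (1 / 4) ^ 2),
      ∑ i, ∑ j, (1 / 4 / √n * w i) * B i j * (1 / 4 / √n * w' j) ≤ C) (z : Fin n → ℝ) :
    ∑ i, (∑ j, B i j * z j) ^ 2 ≤ (2 * C) ^ 2 * ∑ j, z j ^ 2 := by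
  set T : EuclideanSpace ℝ (Fin n) →L[ℝ] EuclideanSpace ℝ (Fin n) :=
    Matrix.toEuclideanCLM (𝕜 := ℝ) B with hT
  have hTapp : ∀ v i, T v i = ∑ j, B i j * v j := fun v i => by
    simp [hT, Matrix.mulVec, dotProduct]
  have hinner : ∀ u v, inner ℝ u (T v) = ∑ i, ∑ j, u i * B i j * v j := by
    intro u v
    simp only [PiLp.inner_apply, hTapp, RCLike.inner_apply, conj_trivial, Finset.sum_mul]
    exact Finset.sum_congr rfl fun i _ => Finset.sum_congr rfl fun j _ => by ring
  have hround : ∀ x : EuclideanSpace ℝ (Fin n), ‖x‖ = 1 →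
      ∃ w ∈ latticePoints n n (n / (1 / 4) ^ 2), ∃ x' : EuclideanSpace ℝ (Fin n),
        (∀ a, x' a = 1 / 4 / √n * w a) ∧ ‖x'‖ ≤ 1 ∧ ‖x - x'‖ ≤ 1 / 4 := by
    intro x hx
    have hx2 : ∑ a, x a ^ 2 ≤ 1 := by
      rw [← EuclideanSpace.real_norm_sq_eq, hx, one_pow]
    obtain ⟨w, hw, -, h1, h2⟩ := exists_lattice_rounding hn (r := 1 / 4) (by norm_num) x hx2
      Finset.univ
    rw [Finset.card_univ, Fintype.card_fin] at hw
    refine ⟨w, hw, WithLp.toLp 2 fun a => 1 / 4 / √n * w a, fun _ => rfl, ?_, ?_⟩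
    · refine (sq_le_sq₀ (norm_nonneg _) zero_le_one).1 ?_
      rw [EuclideanSpace.real_norm_sq_eq, one_pow]
      exact h1
    · refine (sq_le_sq₀ (norm_nonneg _) (by norm_num)).1 ?_
      rw [EuclideanSpace.real_norm_sq_eq]
      simpa using h2
  have hnorm : ‖T‖ ≤ C + ‖T‖ / 2 := by
    refine ContinuousLinearMap.opNorm_le_of_unit_norm (by positivity) fun v hv => ?_
    by_cases hv0 : T v = 0
    · rw [hv0, norm_zero]; positivity
    obtain ⟨u, hu, huv⟩ : ∃ u : EuclideanSpace ℝ (Fin n), ‖u‖ = 1 ∧ inner ℝ u (T v) = ‖T v‖ := by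
      refine ⟨‖T v‖⁻¹ • T v, norm_smul_inv_norm hv0, ?_⟩
      rw [real_inner_smul_left, real_inner_self_eq_norm_sq]
      have := norm_ne_zero_iff.2 hv0
      field_simp
    obtain ⟨w, hw, u', hu', hu1, hu2⟩ := hround u hu
    obtain ⟨w', hw', v', hv', hv1, hv2⟩ := hround v hv
    have e : ‖T v‖ = inner ℝ u' (T v') + inner ℝ (u - u') (T v') + inner ℝ u (T (v - v')) := by
      rw [← huv, map_sub, inner_sub_left, inner_sub_right]; ring
    have h1 : inner ℝ u' (T v') ≤ C := by
      rw [hinner]; simp only [hu', hv']; exact hB w hw w' hw'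
    have h2 : inner ℝ (u - u') (T v') ≤ 1 / 4 * (‖T‖ * 1) :=
      (real_inner_le_norm _ _).trans (mul_le_mul hu2
        ((T.le_opNorm _).trans (mul_le_mul_of_nonneg_left hv1 (norm_nonneg _)))
        (norm_nonneg _) (by norm_num))
    have h3 : inner ℝ u (T (v - v')) ≤ 1 * (‖T‖ * (1 / 4)) :=
      (real_inner_le_norm _ _).trans (mul_le_mul hu.le
        ((T.le_opNorm _).trans (mul_le_mul_of_nonneg_left hv2 (norm_nonneg _)))
        (norm_nonneg _) (by norm_num))
    linarith
  have hT2 : ‖T‖ ≤ 2 * C := by linarith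
  have h := (T.le_opNorm (WithLp.toLp 2 z)).trans
    (mul_le_mul_of_nonneg_right hT2 (norm_nonneg _))
  have h := (sq_le_sq₀ (norm_nonneg _) (by positivity)).2 h
  rw [mul_pow, EuclideanSpace.real_norm_sq_eq, EuclideanSpace.real_norm_sq_eq] at h
  simpa only [hTapp] using h

lemma exp_le_add_exp_sq (x : ℝ) : Real.exp x ≤ x + Real.exp (x ^ 2) := by
  have h2 := Real.add_one_le_exp (x ^ 2)
  rcases le_or_gt |x| 1 with hx | hx
  · have := (abs_le.1 (Real.abs_exp_sub_one_sub_id_le hx)).2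
    linarith
  · rcases lt_abs.1 hx with h | h
    · have : Real.exp x ≤ Real.exp (x ^ 2) := Real.exp_le_exp.2 (by nlinarith)
      linarith
    · have : Real.exp x ≤ 1 := Real.exp_le_one_iff.2 (by linarith)
      nlinarith

lemma bernoulli_mgf_le {p : ℝ} (h0 : 0 ≤ p) (h1 : p ≤ 1) (s : ℝ) :
    p * Real.exp (s * (1 - p)) + (1 - p) * Real.exp (s * (0 - p)) ≤ Real.exp (s ^ 2) := by
  have ha := exp_le_add_exp_sq (s * (1 - p))
  have hb := exp_le_add_exp_sq (s * (0 - p))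
  have ha' : Real.exp ((s * (1 - p)) ^ 2) ≤ Real.exp (s ^ 2) :=
    Real.exp_le_exp.2 (by rw [mul_pow]; exact mul_le_of_le_one_right (sq_nonneg _) (by nlinarith))
  have hb' : Real.exp ((s * (0 - p)) ^ 2) ≤ Real.exp (s ^ 2) :=
    Real.exp_le_exp.2 (by rw [mul_pow]; exact mul_le_of_le_one_right (sq_nonneg _) (by nlinarith))
  nlinarith [mul_le_mul_of_nonneg_left (ha.trans (add_le_add_right ha' _)) h0,
    mul_le_mul_of_nonneg_left (hb.trans (add_le_add_right hb' _)) (sub_nonneg.2 h1)]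

/-- The bilinear form of the centred matrix at a fixed pair of vectors is sub-Gaussian. -/
lemma matExp_exp_bilinear_le {n : ℕ} {p : ℝ} (h0 : 0 ≤ p) (h1 : p ≤ 1) (s : ℝ)
    {u v : Fin n → ℝ} (hu : ∑ i, u i ^ 2 ≤ 1) (hv : ∑ i, v i ^ 2 ≤ 1) :
    matExp p (fun m => Real.exp (s * ∑ i, ∑ j, u i * (bitVal (m i j) - p) * v j)) ≤
      Real.exp (s ^ 2) := by
  have e : ∀ m : Fin n → Fin n → Bool,
      Real.exp (s * ∑ i, ∑ j, u i * (bitVal (m i j) - p) * v j) =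
        ∏ i, ∏ j, Real.exp (s * u i * v j * (bitVal (m i j) - p)) := by
    intro m
    simp_rw [← Real.exp_sum, Finset.mul_sum]
    congr 1
    exact Finset.sum_congr rfl fun i _ => Finset.sum_congr rfl fun j _ => by ring
  simp_rw [e]
  rw [matExp_prod_rows fun i b => ∏ j, Real.exp (s * u i * v j * (bitVal (b j) - p))]
  have hrow : ∀ i, coinExp p (fun b => ∏ j, Real.exp (s * u i * v j * (bitVal (b j) - p))) ≤
      Real.exp (s ^ 2 * u i ^ 2) := by
    intro i
    rw [coinExp_prod fun j b => Real.exp (s * u i * v j * (bitVal b - p))]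
    calc _ ≤ ∏ j, Real.exp ((s * u i * v j) ^ 2) := by
          refine Finset.prod_le_prod (fun j _ => ?_) fun j _ => ?_
          · have : 0 ≤ 1 - p := by linarith
            positivity
          · simpa [bitVal] using bernoulli_mgf_le h0 h1 (s * u i * v j)
      _ = Real.exp (s ^ 2 * u i ^ 2 * ∑ j, v j ^ 2) := by
          rw [← Real.exp_sum, Finset.mul_sum]
          congr 1
          exact Finset.sum_congr rfl fun j _ => by ring
      _ ≤ _ := Real.exp_le_exp.2 (mul_le_of_le_one_right (by positivity) hv)
  calc _ ≤ ∏ i, Real.exp (s ^ 2 * u i ^ 2) := by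
        refine Finset.prod_le_prod (fun i _ => ?_) fun i _ => hrow i
        rw [← coinExp_const (ι := Fin n) (p := p) 0]
        exact coinExp_mono h0 h1 fun b => Finset.prod_nonneg fun _ _ => Real.exp_nonneg _
    _ = Real.exp (s ^ 2 * ∑ i, u i ^ 2) := by rw [← Real.exp_sum, Finset.mul_sum]
    _ ≤ _ := Real.exp_le_exp.2 (mul_le_of_le_one_right (by positivity) hu)

/-- The centred matrix has operator norm `O(√n)` outside an event of probability at most
`q ^ n`, where `q > 0` is as small as desired. -/
lemma exists_centredNorm_bound {p q : ℝ} (h0 : 0 ≤ p) (h1 : p ≤ 1) (hq : 0 < q) :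
    ∃ K > 0, ∀ n : ℕ, 0 < n →
      matExp p ({m : Fin n → Fin n → Bool | ¬ CentredNormLE p K m}.indicator 1) ≤ q ^ n := by
  set G : ℝ := 1 + ∑' w : ℤ, Real.exp (-(1 * (w : ℝ) ^ 2)) with hG
  have hG0 : 0 < G := by
    have : 0 ≤ ∑' w : ℤ, Real.exp (-(1 * (w : ℝ) ^ 2)) := tsum_nonneg fun _ => Real.exp_nonneg _
    linarith
  obtain ⟨K, hKq, hK⟩ : ∃ K : ℝ, Real.exp (-K) < q / (Real.exp 33 * G ^ 2) ∧ 0 < K :=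
    ((Real.tendsto_exp_neg_atTop_nhds_zero.eventually_lt_const
      (by positivity : (0 : ℝ) < q / (Real.exp 33 * G ^ 2))).and
      (Filter.eventually_gt_atTop 0)).exists
  refine ⟨2 * K, by positivity, fun n hn => ?_⟩
  have hn' : (0 : ℝ) < n := by exact_mod_cast hn
  set N := latticePoints n n (n / (1 / 4) ^ 2) with hN
  set h : ℝ := 1 / 4 / √n with hh
  set F : (Fin n → ℤ) × (Fin n → ℤ) → (Fin n → Fin n → Bool) → ℝ :=
    fun w m => ∑ i, ∑ j, (h * w.1 i) * (bitVal (m i j) - p) * (h * w.2 j) with hF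
  have hball : ∀ w ∈ N, ∑ a, (h * (w a : ℝ)) ^ 2 ≤ 1 := by
    intro w hw
    have h2 := (mem_latticePoints.1 hw).2
    simp only [mul_pow, ← Finset.mul_sum]
    rw [hh, div_pow, Real.sq_sqrt hn'.le]
    calc (1 / 4 : ℝ) ^ 2 / n * ∑ a, (w a : ℝ) ^ 2 ≤ (1 / 4) ^ 2 / n * (n / (1 / 4) ^ 2) := by
          gcongr
      _ = 1 := by field_simp
  have hpoint : ∀ m, {m : Fin n → Fin n → Bool | ¬ CentredNormLE p (2 * K) m}.indicator 1 m ≤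
      ∑ w ∈ N ×ˢ N, Real.exp (-(K * n)) * Real.exp (√n * F w m) := by
    intro m
    by_cases hm : CentredNormLE p (2 * K) m
    · rw [Set.indicator_of_notMem (by simpa using hm)]
      exact Finset.sum_nonneg fun _ _ => by positivity
    · rw [Set.indicator_of_mem (by exact hm), Pi.one_apply]
      obtain ⟨w, hw, hlt⟩ : ∃ w ∈ N ×ˢ N, K * √n < F w m := by
        by_contra! hcon
        refine hm fun z => ?_
        have := sum_sq_mulVec_le_of_lattice hn (Matrix.of fun i j => bitVal (m i j) - p)
          (C := K * √n) (by positivity)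
          (fun w hw w' hw' => hcon (w, w') (Finset.mem_product.2 ⟨hw, hw'⟩)) z
        rw [← mul_assoc, mul_pow, Real.sq_sqrt hn'.le] at this
        exact this
      refine le_trans ?_ (Finset.single_le_sum
        (f := fun w => Real.exp (-(K * n)) * Real.exp (√n * F w m))
        (fun _ _ => by positivity) hw)
      rw [← Real.exp_add]
      refine Real.one_le_exp ?_
      have := mul_le_mul_of_nonneg_left hlt.le (Real.sqrt_nonneg n)
      have e : √(n : ℝ) * (K * √n) = K * n := by
        rw [mul_left_comm, Real.mul_self_sqrt hn'.le]
      linarith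
  have hcard : (N.card : ℝ) ≤ (Real.exp 16 * G) ^ n := by
    refine (card_latticePoints_le one_pos le_rfl n n (n / (1 / 4) ^ 2)).trans (le_of_eq ?_)
    rw [mul_pow, ← Real.exp_nat_mul, neg_zero, Real.exp_zero, one_mul]
    congr 2
    · ring
    · rw [hG, one_mul]
  calc _ ≤ matExp p fun m => ∑ w ∈ N ×ˢ N, Real.exp (-(K * n)) * Real.exp (√n * F w m) :=
        matExp_mono h0 h1 hpoint
    _ = ∑ w ∈ N ×ˢ N, Real.exp (-(K * n)) * matExp p fun m => Real.exp (√n * F w m) := by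
        rw [matExp_sum]
        exact Finset.sum_congr rfl fun w _ => matExp_const_mul _ _
    _ ≤ ∑ w ∈ N ×ˢ N, Real.exp (-(K * n)) * Real.exp n := by
        refine Finset.sum_le_sum fun w hw => mul_le_mul_of_nonneg_left ?_ (Real.exp_nonneg _)
        obtain ⟨hw1, hw2⟩ := Finset.mem_product.1 hw
        have := matExp_exp_bilinear_le h0 h1 (√n) (hball _ hw1) (hball _ hw2)
        rwa [Real.sq_sqrt hn'.le] at this
    _ = N.card ^ 2 * (Real.exp (-K) * Real.exp 1) ^ n := by
        rw [Finset.sum_const, Finset.card_product, nsmul_eq_mul, mul_pow, ← Real.exp_nat_mul,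
          ← Real.exp_nat_mul]
        push_cast
        rw [sq]
        congr 3 <;> ring
    _ ≤ ((Real.exp 16 * G) ^ n) ^ 2 * (q / (Real.exp 33 * G ^ 2) * Real.exp 1) ^ n := by
        gcongr
    _ = q ^ n := by
        rw [← pow_mul, mul_comm n 2, pow_mul, ← mul_pow]
        congr 1
        rw [show (33 : ℝ) = 16 + 16 + 1 by norm_num, Real.exp_add, Real.exp_add]
        field_simp

/-! ### Many independent rows -/

/-- Chernoff bound for the number of rows outside `E`, when a row lies in `E` with probability at
most `q`. -/
lemma matExp_few_exceptions_le {n : ℕ} {p q l : ℝ} (h0 : 0 ≤ p) (h1 : p ≤ 1)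
    (E : Set (Fin n → Bool)) (hE : coinExp p (E.indicator 1) ≤ q) (hl : 0 ≤ l) (L : ℝ) :
    matExp p ({m : Fin n → Fin n → Bool | ({i | m i ∉ E}.ncard : ℝ) ≤ L}.indicator 1) ≤
      Real.exp (l * L) * (q + Real.exp (-l)) ^ n := by
  classical
  have hpoint : ∀ m, {m : Fin n → Fin n → Bool | ({i | m i ∉ E}.ncard : ℝ) ≤ L}.indicator 1 m ≤
      Real.exp (l * L) * ∏ i, (E.indicator 1 (m i) + Real.exp (-l)) := by
    intro m
    by_cases hm : ({i | m i ∉ E}.ncard : ℝ) ≤ L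
    · rw [Set.indicator_of_mem (by exact hm), Pi.one_apply]
      have hterm : ∏ i, Real.exp (-(l * if m i ∉ E then 1 else 0)) ≤
          ∏ i, (E.indicator 1 (m i) + Real.exp (-l)) := by
        refine Finset.prod_le_prod (fun _ _ => Real.exp_nonneg _) fun i _ => ?_
        by_cases hi : m i ∈ E <;> simp [hi, Real.exp_nonneg]
      refine le_trans ?_ (mul_le_mul_of_nonneg_left hterm (Real.exp_nonneg _))
      have hcard : ∑ i, (if m i ∉ E then (1 : ℝ) else 0) = ({i | m i ∉ E}.ncard : ℝ) := by
        rw [Set.ncard_eq_toFinset_card', Finset.sum_boole]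
        congr 2
        ext i; simp
      rw [← Real.exp_sum, ← Real.exp_add, Finset.sum_neg_distrib, ← Finset.mul_sum, hcard]
      exact Real.one_le_exp (by nlinarith [mul_le_mul_of_nonneg_left hm hl])
    · rw [Set.indicator_of_notMem (by exact hm)]
      refine mul_nonneg (Real.exp_nonneg _) (Finset.prod_nonneg fun i _ => ?_)
      exact add_nonneg (Set.indicator_nonneg (fun _ _ => zero_le_one) _) (Real.exp_nonneg _)
  refine (matExp_mono h0 h1 hpoint).trans ?_
  rw [matExp_const_mul, matExp_prod_rows fun _ b => E.indicator 1 b + Real.exp (-l),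
    coinExp_add, coinExp_const, Finset.prod_const, Finset.card_univ, Fintype.card_fin]
  have : 0 ≤ coinExp p (E.indicator 1) := by
    rw [← coinExp_const (ι := Fin n) (p := p) 0]
    exact coinExp_mono h0 h1 fun b => Set.indicator_nonneg (fun _ _ => zero_le_one) _
  gcongr

/-! ### Discretising a compressible kernel -/

/-- A compressible vector has all but `2 ρ` of its norm on at most `δ n` coordinates. -/
lemma exists_finset_of_mem_Comp {n : ℕ} {δ ρ : ℝ} (hδ : 0 ≤ δ) (hρ : 0 < ρ)
    {x : EuclideanSpace ℝ (Fin n)} (hx : x ∈ Comp n δ ρ) :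
    ∃ I : Finset (Fin n), (I.card : ℝ) ≤ δ * n ∧ ∑ a ∈ Iᶜ, x a ^ 2 ≤ 4 * ρ ^ 2 := by
  classical
  have hne : (sparseVectors n (δ * n)).Nonempty := ⟨0, by simp [sparseVectors]; positivity⟩
  obtain ⟨s, hs, hxs⟩ := (Metric.infDist_lt_iff hne).1 (show _ < 2 * ρ by linarith [hx.2])
  refine ⟨Finset.univ.filter fun a => s a ≠ 0, ?_, ?_⟩
  · have : ({a | s a ≠ 0}.ncard : ℝ) ≤ δ * n := hs
    rwa [Set.ncard_eq_toFinset_card', Set.toFinset_ofPred] at this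
  · calc ∑ a ∈ (Finset.univ.filter fun a => s a ≠ 0)ᶜ, x a ^ 2
        = ∑ a ∈ (Finset.univ.filter fun a => s a ≠ 0)ᶜ, (x a - s a) ^ 2 := by
          refine Finset.sum_congr rfl fun a ha => ?_
          have : s a = 0 := by simpa using ha
          rw [this, sub_zero]
      _ ≤ ∑ a, (x a - s a) ^ 2 := Finset.sum_le_univ_sum_of_nonneg fun _ => sq_nonneg _
      _ = ‖x - s‖ ^ 2 := by rw [EuclideanSpace.real_norm_sq_eq]; rfl
      _ ≤ (2 * ρ) ^ 2 := by rw [← dist_eq_norm]; gcongr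
      _ = 4 * ρ ^ 2 := by ring

lemma KernelsCompressible.exists_submodule {n k : ℕ} (hkn : k ≤ n) {δ ρ : ℝ} (hδ : 0 ≤ δ)
    (hρ : 0 < ρ) {A : Matrix (Fin n) (Fin n) ℝ} (hA : KernelsCompressible k δ ρ A) :
    ∃ S : Finset (Fin n), S.card + k = n ∧ ∃ V : Submodule ℝ (Fin n → ℝ),
      k ≤ Module.finrank ℝ V ∧ ∀ v ∈ V, (∀ r ∈ S, ∑ a, A r a * v a = 0) ∧
        (∑ a, v a ^ 2 = 1 →
          ∃ I : Finset (Fin n), (I.card : ℝ) ≤ δ * n ∧ ∑ a ∈ Iᶜ, v a ^ 2 ≤ 4 * ρ ^ 2) := by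
  obtain ⟨S, -, hS⟩ := Finset.exists_subset_card_eq
    (show n - k ≤ (Finset.univ : Finset (Fin n)).card by simp)
  have hSk : S.card + k = n := by omega
  set A' := A.submatrix (fun i : S => (i : Fin n)) id with hA'
  refine ⟨S, hSk, LinearMap.ker A'.mulVecLin, ?_, fun v hv => ?_⟩
  · have h1 := A'.mulVecLin.finrank_range_add_finrank_ker
    have h2 := Submodule.finrank_le (LinearMap.range A'.mulVecLin)
    simp only [Module.finrank_fintype_fun_eq_card, Fintype.card_coe, Fintype.card_fin] at h1 h2
    omega
  · have hv' : A' *ᵥ v = 0 := by simpa using hv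
    refine ⟨fun r hr => ?_, fun hv1 => ?_⟩
    · have := congrFun hv' ⟨r, hr⟩
      simpa [hA', Matrix.mulVec, dotProduct] using this
    · refine exists_finset_of_mem_Comp (x := WithLp.toLp 2 v) hδ hρ (hA S hSk _ ?_ hv')
      rw [← sq_eq_sq₀ (norm_nonneg _) zero_le_one, EuclideanSpace.real_norm_sq_eq, one_pow]
      exact hv1

/-- The set of rows `b` with `|⟨b, yᵢ⟩ + tᵢ| ≤ c` for all `i`, where `yᵢ = h wᵢ` and
`tᵢ = (c / 2) Tᵢ` come from the integer data `ω i = (wᵢ, Tᵢ)`. -/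
def rowTube {n k : ℕ} (h c : ℝ) (ω : Fin k → (Fin n → ℤ) × ℤ) : Set (Fin n → Bool) :=
  {b | ∀ i, |∑ a, bitVal (b a) * (h * (ω i).1 a) + c / 2 * (ω i).2| ≤ c}

/-- If all kernels are compressible and the centred matrix has norm `O(√n)`, then some lattice
data `ω`, with small row probability, captures all but few of the rows. Only the centred matrix
has a good norm bound; the mean contributes the same constant to every row, which is recorded, up
to rounding, in the shifts of `ω`. -/
lemma exists_rowTube {n k : ℕ} (hk : 1 ≤ k) (hkn : k ≤ n) {p c τ K δ ρ η : ℝ} (h0 : 0 ≤ p)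
    (h1 : p ≤ 1) (hc : 0 < c) (hδ : 0 ≤ δ) (hρ : 0 < ρ) (hρτ : 3 * ρ ≤ τ)
    (hρc : 6 * ρ ≤ c) (hη : 36 * k * K ^ 2 * ρ ^ 2 / c ^ 2 ≤ η / 2) (hkη : k ≤ η / 2 * n)
    (hrob : ∀ V : Submodule ℝ (Fin n → ℝ), k ≤ Module.finrank ℝ V →
      ∃ x : Fin k → Fin n → ℝ, (∀ i, x i ∈ V) ∧ (∀ i, ∑ a, x i a ^ 2 = 1) ∧
        ∀ (y : Fin k → Fin n → ℝ) (t : Fin k → ℝ), (∀ i, ∑ a, (x i a - y i a) ^ 2 ≤ τ ^ 2) →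
          (∀ i a, x i a = 0 → y i a = 0) →
          coinExp p ({b | ∀ i, |∑ a, bitVal (b a) * y i a + t i| ≤ c}.indicator 1) ≤
            (1 - p) ^ k)
    {m : Fin n → Fin n → Bool} (hm : CentredNormLE p K m)
    (hA : KernelsCompressible k δ ρ (Matrix.of fun i j => bitVal (m i j))) :
    ∃ ω : Fin k → (Fin n → ℤ) × ℤ,
      (∀ i, ω i ∈ latticePoints n (δ * n) (n / ρ ^ 2) ×ˢ Finset.Icc (-(n : ℤ)) n) ∧
      coinExp p ((rowTube (ρ / √n) c ω).indicator 1) ≤ (1 - p) ^ k ∧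
      ({r | m r ∉ rowTube (ρ / √n) c ω}.ncard : ℝ) ≤ η * n := by
  classical
  have hn : 0 < n := by omega
  have hn' : (1 : ℝ) ≤ n := by exact_mod_cast hn
  obtain ⟨S, hS, V, hV, hVS⟩ := hA.exists_submodule hkn hδ hρ
  obtain ⟨x, hxV, hx1, hxrob⟩ := hrob V hV
  choose I hIcard hI using fun i => (hVS (x i) (hxV i)).2 (hx1 i)
  choose w hwmem hwzero hw1 hwx using fun i => exists_lattice_rounding hn hρ (x i) (hx1 i).le (I i)
  set h := ρ / √n with hh
  set z : Fin k → Fin n → ℝ := fun i a => x i a - h * w i a with hz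
  have hz2 : ∀ i, ∑ a, z i a ^ 2 ≤ (3 * ρ) ^ 2 := fun i => by
    have := hwx i
    have := hI i
    nlinarith [sq_nonneg ρ]
  -- `σ i` is what the mean matrix contributes to each row of the rounding error `z i`.
  set σ : Fin k → ℝ := fun i => p * ∑ a, z i a with hσ
  choose T hT1 hT2 using fun i => exists_int_abs_le (σ i / (c / 2))
  have hσn : ∀ i, |σ i| ≤ c / 2 * n := by
    intro i
    refine abs_le_of_sq_le_sq ?_ (by positivity)
    have hcs : (∑ a, z i a) ^ 2 ≤ n * (3 * ρ) ^ 2 := by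
      refine (sq_sum_le_card_mul_sum_sq (s := Finset.univ) (f := z i)).trans ?_
      rw [Finset.card_univ, Fintype.card_fin]
      exact mul_le_mul_of_nonneg_left (hz2 i) (by positivity)
    calc σ i ^ 2 = p ^ 2 * (∑ a, z i a) ^ 2 := by rw [hσ]; ring
      _ ≤ 1 * (n * (3 * ρ) ^ 2) :=
          mul_le_mul (pow_le_one₀ h0 h1) hcs (sq_nonneg _) zero_le_one
      _ ≤ 1 * (n ^ 2 * (c / 2) ^ 2) := by
          have : (n : ℝ) ≤ n ^ 2 := by nlinarith
          gcongr
          linarith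
      _ = (c / 2 * n) ^ 2 := by ring
  refine ⟨fun i => (w i, T i), fun i => ?_, ?_, ?_⟩
  · refine Finset.mem_product.2 ⟨mem_latticePoints.2 ⟨?_, ?_⟩, ?_⟩
    · exact (mem_latticePoints.1 (hwmem i)).1.trans (hIcard i)
    · exact (mem_latticePoints.1 (hwmem i)).2
    · have : |(T i : ℝ)| ≤ n := (hT1 i).trans (by
        rw [abs_div, abs_of_pos (by positivity : (0 : ℝ) < c / 2), div_le_iff₀ (by positivity)]
        linarith [hσn i])
      rw [Finset.mem_Icc, ← abs_le]
      exact_mod_cast this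
  · refine hxrob (fun i a => h * w i a) (fun i => c / 2 * T i) (fun i => ?_) fun i a ha => ?_
    · exact (hz2 i).trans (by gcongr)
    · simp [hwzero i a ha]
  · -- Outside the `k` rows not in `S`, a row can miss the tube only if the centred part of the
    -- error is large there, which the norm bound allows on few rows.
    set bad : Fin k → Finset (Fin n) :=
      fun i => Finset.univ.filter fun r => c / 2 < |∑ a, (bitVal (m r a) - p) * z i a| with hbad
    have hsub : {r | m r ∉ rowTube h c fun i => (w i, T i)} ⊆
        ((Sᶜ ∪ Finset.univ.biUnion bad : Finset (Fin n)) : Set (Fin n)) := by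
      intro r hr
      by_contra hcon
      refine hr fun i => ?_
      simp only [Finset.coe_union, Set.mem_union, Finset.mem_coe, Finset.mem_compl,
        Finset.mem_biUnion, Finset.mem_univ, true_and, hbad, Finset.mem_filter, not_or,
        not_not, not_exists, not_lt] at hcon
      have hker := (hVS (x i) (hxV i)).1 r hcon.1
      simp only [Matrix.of_apply] at hker
      have hsum : ∑ a, bitVal (m r a) * (h * w i a) =
          -(∑ a, (bitVal (m r a) - p) * z i a) - σ i := by
        have : ∑ a, bitVal (m r a) * (h * w i a) = ∑ a, bitVal (m r a) * x i a -
            ∑ a, (bitVal (m r a) - p) * z i a - p * ∑ a, z i a := by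
          rw [Finset.mul_sum, ← Finset.sum_sub_distrib, ← Finset.sum_sub_distrib]
          exact Finset.sum_congr rfl fun a _ => by simp only [hz]; ring
        rw [this, hker]; ring
      have hround : |σ i - c / 2 * T i| ≤ c / 2 := by
        have e : σ i - c / 2 * T i = c / 2 * (σ i / (c / 2) - T i) := by field_simp
        rw [e, abs_mul, abs_of_pos (by positivity : (0 : ℝ) < c / 2)]
        exact mul_le_of_le_one_right (by positivity) (hT2 i)
      have hrow := hcon.2 i
      change |∑ a, bitVal (m r a) * (h * w i a) + c / 2 * T i| ≤ c
      rw [hsum]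
      rw [abs_le] at hround hrow ⊢
      constructor <;> linarith
    have hbadcard : ∀ i, ((bad i).card : ℝ) ≤ 36 * K ^ 2 * ρ ^ 2 / c ^ 2 * n := by
      intro i
      have h2 : (bad i).card * (c / 2) ^ 2 ≤ K ^ 2 * n * (3 * ρ) ^ 2 := by
        calc (bad i).card * (c / 2) ^ 2 = ∑ r ∈ bad i, (c / 2) ^ 2 := by
              rw [Finset.sum_const, nsmul_eq_mul]
          _ ≤ ∑ r ∈ bad i, (∑ a, (bitVal (m r a) - p) * z i a) ^ 2 := by
              refine Finset.sum_le_sum fun r hr => ?_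
              rw [← sq_abs (∑ a, (bitVal (m r a) - p) * z i a)]
              have := (Finset.mem_filter.1 hr).2
              gcongr
          _ ≤ ∑ r, (∑ a, (bitVal (m r a) - p) * z i a) ^ 2 :=
              Finset.sum_le_univ_sum_of_nonneg fun _ => sq_nonneg _
          _ ≤ K ^ 2 * n * ∑ a, z i a ^ 2 := hm (z i)
          _ ≤ _ := mul_le_mul_of_nonneg_left (hz2 i) (by positivity)
      rw [div_mul_eq_mul_div, le_div_iff₀ (by positivity)]
      linarith
    have hSc : (Sᶜ.card : ℝ) = k := by
      rw [Finset.card_compl, Fintype.card_fin, Nat.cast_inj]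
      omega
    calc ({r | m r ∉ rowTube h c fun i => (w i, T i)}.ncard : ℝ)
        ≤ ((Sᶜ ∪ Finset.univ.biUnion bad).card : ℝ) := by
          rw [← Set.ncard_coe_finset]
          exact_mod_cast Set.ncard_le_ncard hsub (Finset.finite_toSet _)
      _ ≤ Sᶜ.card + ∑ i, (bad i).card := by
          exact_mod_cast (Finset.card_union_le _ _).trans
            (add_le_add_right Finset.card_biUnion_le _)
      _ ≤ k + ∑ i : Fin k, 36 * K ^ 2 * ρ ^ 2 / c ^ 2 * n := by
          rw [hSc]
          push_cast
          exact add_le_add_right (Finset.sum_le_sum fun i _ => hbadcard i) _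
      _ = k + 36 * k * K ^ 2 * ρ ^ 2 / c ^ 2 * n := by
          rw [Finset.sum_const, Finset.card_univ, Fintype.card_fin, nsmul_eq_mul]; ring
      _ ≤ η * n := by
          have := mul_le_mul_of_nonneg_right hη (by linarith : (0 : ℝ) ≤ n)
          linarith

/-! ### The union bound -/

lemma exists_base_between {q Q : ℝ} (hqQ : q < Q) (d : ℕ) : ∃ h : ℝ, 1 < h ∧ q * h ^ d < Q := by
  have hcont : Filter.Tendsto (fun h : ℝ => q * h ^ d) (nhdsWithin 1 (Set.Ioi 1))
      (nhds (q * 1 ^ d)) :=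
    (Continuous.tendsto (by fun_prop) 1).mono_left nhdsWithin_le_nhds
  rw [one_pow, mul_one] at hcont
  obtain ⟨h, h2, h1⟩ := ((hcont.eventually_lt_const hqQ).and self_mem_nhdsWithin).exists
  exact ⟨h, h1, h2⟩

lemma exists_exp_neg_mul_le {a : ℝ} (ha : 0 < a) (C : ℝ) : ∃ l > 0, Real.exp (-l) * C ≤ a := by
  have hlim := (Real.tendsto_exp_neg_atTop_nhds_zero.mul_const C)
  rw [zero_mul] at hlim
  obtain ⟨l, h1, h2⟩ := ((hlim.eventually_le_const ha).and (Filter.eventually_gt_atTop 0)).exists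
  exact ⟨l, h2, h1⟩

lemma exists_two_mul_add_one_le_pow {h : ℝ} (hh : 1 < h) :
    ∃ n₀ : ℕ, ∀ n ≥ n₀, (2 * n + 1 : ℝ) ≤ h ^ n := by
  have hlim := tendsto_pow_const_div_const_pow_of_one_lt 1 hh
  obtain ⟨n₀, hn₀⟩ := Filter.eventually_atTop.1
    ((hlim.eventually_le_const (show (0 : ℝ) < 1 / 3 by norm_num)).and
      (Filter.eventually_ge_atTop 1))
  refine ⟨n₀, fun n hn => ?_⟩
  obtain ⟨h1, h2⟩ := hn₀ n hn
  have h2' : (1 : ℝ) ≤ n := by exact_mod_cast h2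
  rw [pow_one, div_le_iff₀ (by positivity)] at h1
  linarith

/-- When `δ n < 1` no unit vector is compressible, so not all kernels can be compressible. -/
lemma not_kernelsCompressible_of_lt_one {n k : ℕ} (hk : 1 ≤ k) (hkn : k ≤ n) {δ ρ : ℝ}
    (hδ : 0 ≤ δ) (hδn : δ * n < 1) (hρ : 0 < ρ) (hρ2 : ρ < 1 / 2) {A : Matrix (Fin n) (Fin n) ℝ} :
    ¬ KernelsCompressible k δ ρ A := by
  intro hA
  obtain ⟨S, -, V, hV, hVS⟩ := hA.exists_submodule hkn hδ hρ
  have hle : ∀ x ∈ V, ∑ a, x a ^ 2 = 1 → False := by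
    intro x hx hx1
    obtain ⟨I, hI, hIx⟩ := (hVS x hx).2 hx1
    have hI0 : I.card < 1 := by exact_mod_cast hI.trans_lt hδn
    have : I = ∅ := Finset.card_eq_zero.1 (by omega)
    rw [this, Finset.compl_empty, hx1] at hIx
    nlinarith
  obtain ⟨x, -, hxV, hx1, -⟩ := exists_triangular_system (τ := 0) k V hV
    fun x hx hx1 => (hle x hx hx1).elim
  exact hle _ (hxV ⟨0, hk⟩) (hx1 ⟨0, hk⟩)

theorem proposition2p2 (p : unitInterval) (hp_pos : 0 < (p : ℝ)) (hp_half : (p : ℝ) ≤ 1 / 2)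
    (k : ℕ) (hk : 1 ≤ k) (ε : ℝ) (hε : 0 < ε) :
    ∃ δ ∈ Set.Ioo (0 : ℝ) 1, ∃ ρ ∈ Set.Ioo (0 : ℝ) 1,
      ∀ n : ℕ, k ≤ n →
        ∀ (Ω : Type*) [MeasurableSpace Ω] (P : Measure Ω) [IsProbabilityMeasure P]
          (M : Ω → Matrix (Fin n) (Fin n) ℝ), IsBernoulliMatrix p M P →
          P.real {ω | KernelsCompressible k δ ρ (M ω)} ≤ (1 - (p : ℝ) + ε) ^ (k * n) := by
  have h0 : (0 : ℝ) ≤ p := hp_pos.le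
  have h1 : (p : ℝ) ≤ 1 := by linarith
  set q : ℝ := (1 - (p : ℝ)) ^ k with hq
  have hq0 : 0 < q := pow_pos (by linarith) k
  have hqQ : q < (1 - (p : ℝ) + ε) ^ k :=
    pow_lt_pow_left₀ (by linarith) (by linarith) (by omega)
  -- The slack between `q` and the target base is split into `4 k + 3` factors `h`.
  obtain ⟨h, hh1, hhQ⟩ := exists_base_between hqQ (4 * k + 3)
  have hh0 : 0 < h := by linarith
  have hlog : 0 < Real.log h := Real.log_pos hh1
  obtain ⟨l, hl, hlq⟩ := exists_exp_neg_mul_le (mul_pos hq0 (sub_pos.2 hh1)) 1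
  set η : ℝ := Real.log h / l with hη
  have hη0 : 0 < η := by positivity
  obtain ⟨c, hc, τ, hτ, hrob⟩ := exists_robust_tuple hp_pos hp_half hk
  obtain ⟨K, hK, hKn⟩ := exists_centredNorm_bound h0 h1 hq0
  obtain ⟨ρ, hρ, hρτ, hρc, hρ2, hρη⟩ : ∃ ρ : ℝ, 0 < ρ ∧ 3 * ρ ≤ τ ∧ 6 * ρ ≤ c ∧ ρ < 1 / 2 ∧
      36 * k * K ^ 2 * ρ ^ 2 / c ^ 2 ≤ η / 2 := by
    have hlim : Filter.Tendsto (fun ρ : ℝ => 36 * k * K ^ 2 * ρ ^ 2 / c ^ 2)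
        (nhdsWithin 0 (Set.Ioi 0)) (nhds (36 * k * K ^ 2 * 0 ^ 2 / c ^ 2)) :=
      (Continuous.tendsto (by fun_prop) 0).mono_left nhdsWithin_le_nhds
    have e : 36 * k * K ^ 2 * (0 : ℝ) ^ 2 / c ^ 2 = 0 := by simp
    rw [e] at hlim
    have hpos : (0 : ℝ) < min (min (τ / 3) (c / 6)) (1 / 2) := by positivity
    obtain ⟨ρ, ha, hb⟩ := ((hlim.eventually_le_const (half_pos hη0)).and
      (Ioo_mem_nhdsGT hpos)).exists
    have hb2 := hb.2
    simp only [lt_min_iff] at hb2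
    exact ⟨ρ, hb.1, by linarith, by linarith, hb2.2, ha⟩
  set s : ℝ := ρ ^ 2 * Real.log h with hs
  have hs0 : 0 < s := by positivity
  obtain ⟨u, hu, huC⟩ := exists_exp_neg_mul_le (sub_pos.2 hh1)
    (∑' w : ℤ, Real.exp (-(s * (w : ℝ) ^ 2)))
  obtain ⟨n₁, hn₁⟩ := exists_two_mul_add_one_le_pow hh1
  obtain ⟨n₂, hn₂⟩ := exists_nat_ge (k / (η / 2))
  set n₀ : ℕ := n₁ + n₂ with hn₀
  set δ : ℝ := min (Real.log h / u) (1 / (n₀ + 2)) with hδ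
  have hδ0 : 0 < δ := by positivity
  have hδu : u * δ ≤ Real.log h := by
    rw [mul_comm, ← le_div_iff₀ hu]; exact min_le_left _ _
  have hδn₀ : δ ≤ 1 / (n₀ + 2) := min_le_right _ _
  have hn₀' : (0 : ℝ) ≤ n₀ := by positivity
  refine ⟨δ, ⟨hδ0, hδn₀.trans_lt ((div_lt_one (by positivity)).2 (by linarith))⟩,
    ρ, ⟨hρ, by linarith⟩, fun n hkn Ω _ P _ M hM => ?_⟩
  refine (hM.measureReal_le_matExp {A | KernelsCompressible k δ ρ A}).trans ?_
  rcases le_or_gt n n₀ with hn | hn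
  · -- For bounded `n` the event is empty, because `δ n < 1`.
    have hδn : δ * n < 1 := by
      have hnn : (n : ℝ) ≤ n₀ := by exact_mod_cast hn
      calc δ * n ≤ 1 / (n₀ + 2) * n₀ := by gcongr
        _ < 1 := by rw [one_div, inv_mul_lt_iff₀ (by positivity)]; linarith
    have hempty : {m : Fin n → Fin n → Bool | Matrix.of (fun i j => bitVal (m i j)) ∈
        {A | KernelsCompressible k δ ρ A}} = ∅ :=
      Set.eq_empty_of_forall_notMem fun m hm =>
        not_kernelsCompressible_of_lt_one hk hkn hδ0.le hδn hρ hρ2 hm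
    rw [hempty]
    simp only [matExp, Set.indicator_empty, mul_zero, Finset.sum_const_zero]
    have : 0 ≤ 1 - (p : ℝ) + ε := by linarith
    positivity
  have hnpos : 0 < n := by omega
  have hpoly : (2 * n + 1 : ℝ) ≤ h ^ n := hn₁ n (by omega)
  have hkη : (k : ℝ) ≤ η / 2 * n := by
    rw [mul_comm, ← div_le_iff₀ (by positivity)]
    exact hn₂.trans (by exact_mod_cast (by omega : n₂ ≤ n))
  have hexplog : Real.exp (Real.log h * n) = h ^ n := by
    rw [mul_comm, Real.exp_nat_mul, Real.exp_log hh0]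
  set N := latticePoints n (δ * n) (n / ρ ^ 2) with hN
  have hNcard : (N.card : ℝ) ≤ (h ^ n) ^ 3 := by
    calc (N.card : ℝ) ≤ Real.exp (u * (δ * n) + s * (n / ρ ^ 2)) *
          (1 + Real.exp (-u) * ∑' w : ℤ, Real.exp (-(s * (w : ℝ) ^ 2))) ^ n :=
          card_latticePoints_le hs0 hu.le _ _ _
      _ ≤ (Real.exp (Real.log h * n) * Real.exp (Real.log h * n)) * h ^ n := by
          have htsum : 0 ≤ ∑' w : ℤ, Real.exp (-(s * (w : ℝ) ^ 2)) :=
            tsum_nonneg fun _ => Real.exp_nonneg _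
          rw [← Real.exp_add]
          have e1 : u * (δ * n) ≤ Real.log h * n := by
            rw [← mul_assoc]; gcongr
          have e2 : s * (n / ρ ^ 2) = Real.log h * n := by rw [hs]; field_simp
          exact mul_le_mul (Real.exp_le_exp.2 (add_le_add e1 e2.le))
            (pow_le_pow_left₀ (by positivity) (by linarith) n) (by positivity) (by positivity)
      _ = (h ^ n) ^ 3 := by rw [hexplog]; ring
  -- The net: `k` lattice vectors with shifts, restricted to the tuples of small row probability.
  set cfg : Finset (Fin k → (Fin n → ℤ) × ℤ) :=
    (Fintype.piFinset fun _ : Fin k => N ×ˢ Finset.Icc (-(n : ℤ)) n).filter fun ω =>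
      coinExp p ((rowTube (ρ / √n) c ω).indicator 1) ≤ q with hcfg
  have hcfgcard : (cfg.card : ℝ) ≤ ((h ^ n) ^ 4) ^ k := by
    have e : (cfg.card : ℝ) ≤ (N.card * (2 * n + 1) : ℝ) ^ k := by
      have : cfg.card ≤ (N.card * (2 * n + 1)) ^ k := by
        refine (Finset.card_filter_le _ _).trans (le_of_eq ?_)
        rw [Fintype.card_piFinset, Finset.prod_const, Finset.card_univ, Fintype.card_fin,
          Finset.card_product, Int.card_Icc]
        congr 2
        omega
      exact_mod_cast this
    refine e.trans (pow_le_pow_left₀ (by positivity) ?_ k)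
    calc (N.card * (2 * n + 1) : ℝ) ≤ (h ^ n) ^ 3 * h ^ n := by gcongr
      _ = (h ^ n) ^ 4 := by ring
  have hpoint : ∀ m : Fin n → Fin n → Bool,
      {m : Fin n → Fin n → Bool | Matrix.of (fun i j => bitVal (m i j)) ∈
        {A | KernelsCompressible k δ ρ A}}.indicator (1 : (Fin n → Fin n → Bool) → ℝ) m ≤
      {m : Fin n → Fin n → Bool | ¬ CentredNormLE p K m}.indicator 1 m +
        ∑ ω ∈ cfg, {m : Fin n → Fin n → Bool |
          ({r | m r ∉ rowTube (ρ / √n) c ω}.ncard : ℝ) ≤ η * n}.indicator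
            (1 : (Fin n → Fin n → Bool) → ℝ) m := by
    intro m
    have hnn1 : 0 ≤ {m : Fin n → Fin n → Bool | ¬ CentredNormLE p K m}.indicator
        (1 : (Fin n → Fin n → Bool) → ℝ) m :=
      Set.indicator_nonneg (fun _ _ => zero_le_one) _
    have hnn2 : ∀ ω ∈ cfg, 0 ≤ {m : Fin n → Fin n → Bool |
          ({r | m r ∉ rowTube (ρ / √n) c ω}.ncard : ℝ) ≤ η * n}.indicator
            (1 : (Fin n → Fin n → Bool) → ℝ) m :=
      fun ω _ => Set.indicator_nonneg (fun _ _ => zero_le_one) _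
    by_cases hm : KernelsCompressible k δ ρ (Matrix.of fun i j => bitVal (m i j))
    · rw [Set.indicator_of_mem (by exact hm), Pi.one_apply]
      by_cases hKm : CentredNormLE p K m
      · obtain ⟨ω, hω1, hω2, hω3⟩ := exists_rowTube hk hkn h0 h1 hc hδ0.le hρ hρτ hρc hρη hkη
          (hrob n) hKm hm
        have hω : ω ∈ cfg := Finset.mem_filter.2 ⟨Fintype.mem_piFinset.2 hω1, hω2⟩
        refine le_trans ?_ (le_add_of_nonneg_left hnn1)
        refine le_trans (le_of_eq ?_) (Finset.single_le_sum hnn2 hω)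
        rw [Set.indicator_of_mem (by exact hω3), Pi.one_apply]
      · rw [Set.indicator_of_mem (by exact hKm), Pi.one_apply]
        exact le_add_of_nonneg_right (Finset.sum_nonneg hnn2)
    · rw [Set.indicator_of_notMem (by exact hm)]
      exact add_nonneg hnn1 (Finset.sum_nonneg hnn2)
  have htube : ∀ ω ∈ cfg, matExp p ({m : Fin n → Fin n → Bool |
      ({r | m r ∉ rowTube (ρ / √n) c ω}.ncard : ℝ) ≤ η * n}.indicator 1) ≤
        h ^ n * (q * h) ^ n := by
    intro ω hω
    refine (matExp_few_exceptions_le h0 h1 _ (Finset.mem_filter.1 hω).2 hl.le (η * n)).trans ?_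
    have e : l * (η * n) = Real.log h * n := by rw [hη]; field_simp
    rw [e, hexplog]
    gcongr
    linarith
  have hhn : 1 ≤ h ^ n := one_le_pow₀ hh1.le
  calc _ ≤ matExp p fun m => {m : Fin n → Fin n → Bool | ¬ CentredNormLE p K m}.indicator 1 m +
        ∑ ω ∈ cfg, {m : Fin n → Fin n → Bool |
          ({r | m r ∉ rowTube (ρ / √n) c ω}.ncard : ℝ) ≤ η * n}.indicator 1 m :=
        matExp_mono h0 h1 hpoint
    _ ≤ q ^ n + ∑ ω ∈ cfg, h ^ n * (q * h) ^ n := by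
        rw [matExp_add, matExp_sum]
        exact add_le_add (hKn n hnpos) (Finset.sum_le_sum htube)
    _ = q ^ n + cfg.card * (h ^ n * (q * h) ^ n) := by rw [Finset.sum_const, nsmul_eq_mul]
    _ ≤ q ^ n * (h ^ n) ^ (4 * k + 2) + ((h ^ n) ^ 4) ^ k * (h ^ n * (q * h) ^ n) := by
        refine add_le_add (le_mul_of_one_le_right (by positivity) (one_le_pow₀ hhn)) ?_
        gcongr
    _ = 2 * (q ^ n * (h ^ n) ^ (4 * k + 2)) := by
        rw [mul_pow, ← pow_mul (h ^ n) 4 k]; ring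
    _ ≤ h ^ n * (q ^ n * (h ^ n) ^ (4 * k + 2)) := by
        have : (1 : ℝ) ≤ n := by exact_mod_cast hnpos
        gcongr
        linarith
    _ = (q * h ^ (4 * k + 3)) ^ n := by
        rw [mul_pow, ← pow_mul h (4 * k + 3) n, mul_comm (4 * k + 3) n, pow_mul h n (4 * k + 3)]
        ring
    _ ≤ ((1 - (p : ℝ) + ε) ^ k) ^ n := by gcongr
    _ = (1 - (p : ℝ) + ε) ^ (k * n) := (pow_mul _ _ _).symm
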